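/- Let $U$ denote the hyperbolic plane and let $\Lambda=(-E_8)^{\oplus 2}\oplus U^{\oplus 3}$ be the K3 lattice (the even unimodular lattice of signature $(3,19)$, isomorphic to $H^2(M,\mathbb Z)$ for $M$ the differentiable manifold underlying a K3 surface). Let $\widetilde\Lambda=\Lambda\oplus(H^0\oplus H^4)$ with $H^0=H^4=\mathbb Z$, endowed with the Mukai pairing $\langle (r,l,s),(r',l',s')\rangle=(l,l')-rs'-sr'$, where $r,r'\in H^0$, $l,l'\in\Lambda$, $s,s'\in H^4$; thus $\widetilde\Lambda\cong\Lambda\oplus U$ with $U=H^0\oplus H^4$, and $\widetilde\Lambda$ has signature $(4,20)$. For a lattice $\Gamma$ of signature $(k,t)$ let ${\rm O}_+(\Gamma)$ be the group of isometries of $\Gamma$ preserving the orientation of the $k$ positive directions, i.e. those $g$ such that for a positive definite $k$-dimensional subspace $V\subset\Gamma_{\mathbb R}$ the composition of $g_{\mathbb R}|_V$ with the orthogonal projection $\Gamma_{\mathbb R}\to V$ has positive determinant (this does not depend on $V$). Regard ${\rm O}_+(\Lambda)$ and ${\rm O}_+(U)$ as groups of automorphisms of $\widetilde\Lambda=\Lambda\oplus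 U$, acting trivially on the other summand. For $B\in\Lambda$ let $\exp(B)$ be the automorphism $(r,l,s)\mapsto\bigl(r,\;l+rB,\;s+(B,l)+r\tfrac{B^2}{2}\bigr)$ of $\widetilde\Lambda$, and let $\exp(\Lambda)=\{\exp(B)\mid B\in\Lambda\}$. Let $$Q=\{x\in\mathbb P(\Lambda_{\mathbb C})\mid (x,x)=0,\ (x,\bar x)>0\},\qquad Q_{\rm alg}=\{x\in Q\mid \exists\, B\in\Lambda:\ (B,x)=0,\ (B,B)>0\},$$ viewed as subsets of $\mathbb P(\widetilde\Lambda_{\mathbb C})$ via $\Lambda\subset\widetilde\Lambda$, and define $$H=\{g\in{\rm O}_+(\widetilde\Lambda)\mid g(Q)\cap Q\neq\emptyset\},\qquad H_{\rm alg}=\{g\in{\rm O}_+(\widetilde\Lambda)\mid g(Q_{\rm alg})\cap Q_{\rm alg}\neq\emptyset\}.$$ Then: 1. $H_{\rm alg}\subset H\subset{\rm O}_+(\widetilde\Lambda)$, and both $H_{\rm alg}$ and $H$ contain the subgroups ${\rm O}_+(\Lambda)$, ${\rm O}_+(U)$ and $\exp(\Lambda)$. 2. The subgroups ${\rm O}_+(\Lambda)$,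 ${\rm O}_+(U)$, $\exp(\Lambda)$ together generate ${\rm O}_+(\widetilde\Lambda)$; hence so does each of $H_{\rm alg}$ and $H$. 3. $H\neq{\rm O}_+(\widetilde\Lambda)$ (hence also $H_{\rm alg}\neq{\rm O}_+(\widetilde\Lambda)$); equivalently, neither $H$ nor $H_{\rm alg}$ is a subgroup of ${\rm O}_+(\widetilde\Lambda)$. -/

import Mathlib

open scoped TensorProduct LinearAlgebra.Projectivization Kronecker

noncomputable section

/-! ## Isometries of lattices and orientations of the positive directions -/

/-- The orthogonal group `O(Γ)` of a lattice `Γ` with integral bilinear form `b`. -/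
def isometryGroup {Γ : Type} [AddCommGroup Γ] (b : LinearMap.BilinForm ℤ Γ) :
    Subgroup (Γ ≃ₗ[ℤ] Γ) where
  carrier := {g | ∀ x y, b (g x) (g y) = b x y}
  mul_mem' := by
    intro g h hg hh x y
    rw [LinearEquiv.mul_apply, LinearEquiv.mul_apply, hg, hh]
  one_mem' := fun _ _ => rfl
  inv_mem' := by
    intro g hg x y
    rw [← hg (g⁻¹ x) (g⁻¹ y), ← LinearEquiv.mul_apply, ← LinearEquiv.mul_apply, mul_inv_cancel]
    rfl

/-- `v` is an ordered basis of a `k`-dimensional subspace of `Γ_ℝ = ℝ ⊗ Γ` on which the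
real extension of `b` is positive definite (an oriented positive `k`-space). -/
def IsPositiveFrame {Γ : Type} [AddCommGroup Γ] (b : LinearMap.BilinForm ℤ Γ) {k : ℕ}
    (v : Fin k → ℝ ⊗[ℤ] Γ) : Prop :=
  (Matrix.of fun i j => b.baseChange ℝ (v i) (v j)).PosDef

/-- The real extension of an isometry is an isometry. -/
theorem baseChange_isometry {Γ : Type} [AddCommGroup Γ] {b : LinearMap.BilinForm ℤ Γ}
    {g : Γ ≃ₗ[ℤ] Γ} (hg : g ∈ isometryGroup b) (x y : ℝ ⊗[ℤ] Γ) :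
    b.baseChange ℝ (g.baseChange ℤ ℝ Γ Γ x) (g.baseChange ℤ ℝ Γ Γ y) = b.baseChange ℝ x y := by
  induction x with
  | zero => simp
  | add x x' hx hx' => simp only [map_add, LinearMap.add_apply, hx, hx']
  | tmul a m =>
    induction y with
    | zero => simp
    | add y y' hy hy' => simp only [map_add, hy, hy']
    | tmul a' m' =>
      rw [LinearEquiv.baseChange_tmul, LinearEquiv.baseChange_tmul,
        LinearMap.BilinForm.baseChange_tmul, LinearMap.BilinForm.baseChange_tmul, hg m m']

theorem isPositiveFrame_baseChange {Γ : Type} [AddCommGroup Γ] {b : LinearMap.BilinForm ℤ Γ}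
    {g : Γ ≃ₗ[ℤ] Γ} (hg : g ∈ isometryGroup b) {k : ℕ} {v : Fin k → ℝ ⊗[ℤ] Γ}
    (hv : IsPositiveFrame b v) :
    IsPositiveFrame b (fun i => g.baseChange ℤ ℝ Γ Γ (v i)) := by
  unfold IsPositiveFrame at *
  simpa only [baseChange_isometry hg] using hv

/-- For two families `v`, `w` with `w` a positive frame: the orthogonal projection to the positive
space spanned by `w` maps `v` to a basis that has the same orientation as `w`.
(The matrix of the projections of the `v i` in the basis `w` is the matrix of the `b(v i, w j)`
times the inverse of the Gram matrix of `w`, and the latter has positive determinant.) -/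
def ProjectsOrientedly {Γ : Type} [AddCommGroup Γ] (b : LinearMap.BilinForm ℤ Γ) {k : ℕ}
    (v w : Fin k → ℝ ⊗[ℤ] Γ) : Prop :=
  0 < (Matrix.of fun i j => b.baseChange ℝ (v i) (w j)).det

/-- The group `O₊(Γ)` of isometries of a lattice `Γ` of signature `(k, t)` that preserve the
orientation of the `k` positive directions: whenever oriented positive `k`-spaces
`V` and `V'` have the same orientation (i.e. the orthogonal projection `V → V'` is oriented), then
the composition of `g_ℝ : V → Γ_ℝ` with the orthogonal projection `Γ_ℝ → V'` is also oriented,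
and conversely. -/
def orientedIsometryGroup {Γ : Type} [AddCommGroup Γ] (b : LinearMap.BilinForm ℤ Γ) (k : ℕ) :
    Subgroup (Γ ≃ₗ[ℤ] Γ) where
  carrier := {g | g ∈ isometryGroup b ∧
    ∀ v w : Fin k → ℝ ⊗[ℤ] Γ, IsPositiveFrame b v → IsPositiveFrame b w →
      (ProjectsOrientedly b v w ↔
        ProjectsOrientedly b (fun i => g.baseChange ℤ ℝ Γ Γ (v i)) w)}
  mul_mem' := by
    rintro g h ⟨hg, hg'⟩ ⟨hh, hh'⟩
    refine ⟨mul_mem hg hh, fun v w hv hw => ?_⟩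
    rw [hh' v w hv hw, hg' _ w (isPositiveFrame_baseChange hh hv) hw]
    simp [LinearEquiv.baseChange_mul]
  one_mem' := ⟨one_mem _, fun v w _ _ => by simp [LinearEquiv.baseChange_one]⟩
  inv_mem' := by
    rintro g ⟨hg, hg'⟩
    refine ⟨inv_mem hg, fun v w hv hw => ?_⟩
    rw [hg' _ w (isPositiveFrame_baseChange (inv_mem hg) hv) hw]
    simp [← LinearEquiv.mul_apply, ← LinearEquiv.baseChange_mul, LinearEquiv.baseChange_one]

/-! ## The K3 lattice, the hyperbolic plane and the Mukai lattice -/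

/-- The rank 22 group underlying the K3 lattice: two summands of rank 8, three of rank 2. -/
abbrev K3Lattice : Type := (Fin 2 × Fin 8) ⊕ (Fin 3 × Fin 2) → ℤ

/-- The Gram matrix of `(-E₈)^{⊕2} ⊕ U^{⊕3}`. -/
def k3Gram : Matrix ((Fin 2 × Fin 8) ⊕ (Fin 3 × Fin 2)) ((Fin 2 × Fin 8) ⊕ (Fin 3 × Fin 2)) ℤ :=
  Matrix.fromBlocks
    ((1 : Matrix (Fin 2) (Fin 2) ℤ) ⊗ₖ (-CartanMatrix.E₈)) 0
    0 ((1 : Matrix (Fin 3) (Fin 3) ℤ) ⊗ₖ !![0, 1; 1, 0])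

/-- The intersection form on `Λ = H²(M, ℤ)`. -/
def k3Form : LinearMap.BilinForm ℤ K3Lattice := Matrix.toBilin' k3Gram

theorem k3Gram_transpose : k3Gram.transpose = k3Gram := by decide

theorem k3Gram_diag_even (i : (Fin 2 × Fin 8) ⊕ (Fin 3 × Fin 2)) : Even (k3Gram i i) := by
  revert i; decide

theorem k3Form_apply (x y : K3Lattice) : k3Form x y = ∑ i, ∑ j, x i * k3Gram i j * y j := by
  simp [k3Form, Matrix.toBilin'_apply]

theorem k3Form_comm (x y : K3Lattice) : k3Form x y = k3Form y x := by
  rw [k3Form_apply, k3Form_apply, Finset.sum_comm]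
  refine Finset.sum_congr rfl fun i _ => Finset.sum_congr rfl fun j _ => ?_
  have h : k3Gram j i = k3Gram i j := congrFun (congrFun k3Gram_transpose i) j
  rw [h]; ring

/-- The K3 lattice is even. -/
theorem k3Form_even (x : K3Lattice) : Even (k3Form x x) := by
  rw [even_iff_two_dvd]
  refine (ZMod.intCast_zmod_eq_zero_iff_dvd _ 2).mp ?_
  rw [k3Form_apply, ← Fintype.sum_prod_type', Int.cast_sum]
  refine Finset.sum_involution (fun p _ => p.swap) ?_ ?_ (fun _ _ => Finset.mem_univ _)
    (fun p _ => Prod.swap_swap p)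
  · rintro ⟨i, j⟩ -
    have h : k3Gram j i = k3Gram i j := congrFun (congrFun k3Gram_transpose i) j
    simp only [Prod.swap, h]
    rw [← Int.cast_add, ZMod.intCast_zmod_eq_zero_iff_dvd]
    exact ⟨x i * k3Gram i j * x j, by push_cast; ring⟩
  · rintro ⟨i, j⟩ - hne hs
    simp only [Prod.swap, Prod.mk.injEq] at hs
    obtain rfl := hs.1
    apply hne
    obtain ⟨c, hc⟩ := k3Gram_diag_even j
    rw [ZMod.intCast_zmod_eq_zero_iff_dvd]
    exact ⟨x j * c * x j, by simp only [hc]; push_cast; ring⟩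

/-- The group `U = H⁰(M, ℤ) ⊕ H⁴(M, ℤ)`; an element is `(r, s)` with `r ∈ H⁰`, `s ∈ H⁴`. -/
abbrev HypPlane : Type := ℤ × ℤ

/-- The negative of the intersection pairing on `H⁰ ⊕ H⁴`: `⟨(r,s),(r',s')⟩ = -rs' - sr'`. -/
def hypForm : LinearMap.BilinForm ℤ HypPlane :=
  LinearMap.mk₂ ℤ (fun x y => -(x.1 * y.2) - x.2 * y.1)
    (by intros; simp; ring) (by intros; simp; ring) (by intros; simp; ring) (by intros; simp; ring)

/-- The Mukai lattice `Λ̃ = Λ ⊕ U = H*(M, ℤ)`; an element is `(l, (r, s))` with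
`l ∈ H²`, `r ∈ H⁰`, `s ∈ H⁴`. -/
abbrev MukaiLattice : Type := K3Lattice × HypPlane

/-- The Mukai pairing, the orthogonal sum of the pairings on `Λ` and `U`. -/
def mukaiForm : LinearMap.BilinForm ℤ MukaiLattice :=
  k3Form.compl₁₂ (LinearMap.fst ℤ _ _) (LinearMap.fst ℤ _ _) +
    hypForm.compl₁₂ (LinearMap.snd ℤ _ _) (LinearMap.snd ℤ _ _)

/-- `O₊(Λ)`, with `Λ` of signature `(3, 19)`. -/
def OplusK3 : Subgroup (K3Lattice ≃ₗ[ℤ] K3Lattice) := orientedIsometryGroup k3Form 3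

/-- `O₊(U)`, with `U` of signature `(1, 1)`. -/
def OplusHyp : Subgroup (HypPlane ≃ₗ[ℤ] HypPlane) := orientedIsometryGroup hypForm 1

/-- `O₊(Λ̃)`, with `Λ̃` of signature `(4, 20)`. -/
def OplusMukai : Subgroup (MukaiLattice ≃ₗ[ℤ] MukaiLattice) := orientedIsometryGroup mukaiForm 4

/-- Extension of an automorphism of `Λ` to `Λ̃ = Λ ⊕ U` by the identity of `U`. -/
def extendK3 : (K3Lattice ≃ₗ[ℤ] K3Lattice) →* (MukaiLattice ≃ₗ[ℤ] MukaiLattice) where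
  toFun g := g.prodCongr (LinearEquiv.refl ℤ HypPlane)
  map_one' := rfl
  map_mul' _ _ := rfl

/-- Extension of an automorphism of `U` to `Λ̃ = Λ ⊕ U` by the identity of `Λ`. -/
def extendHyp : (HypPlane ≃ₗ[ℤ] HypPlane) →* (MukaiLattice ≃ₗ[ℤ] MukaiLattice) where
  toFun g := (LinearEquiv.refl ℤ K3Lattice).prodCongr g
  map_one' := rfl
  map_mul' _ _ := rfl

/-! ## The isometries `exp(B)` -/

/-- Multiplication with `1 + B + B²/2` in `H*(M, ℤ)`:
`(r, l, s) ↦ (r, l + rB, s + (B, l) + r B²/2)`. The division is exact since `Λ` is even. -/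
def mukaiExpMap (B : K3Lattice) (x : MukaiLattice) : MukaiLattice :=
  (x.1 + x.2.1 • B, (x.2.1, x.2.2 + k3Form B x.1 + x.2.1 * (k3Form B B / 2)))

theorem mukaiExpMap_zero (x : MukaiLattice) : mukaiExpMap 0 x = x := by
  simp [mukaiExpMap]

theorem mukaiExpMap_comp (B C : K3Lattice) (x : MukaiLattice) :
    mukaiExpMap B (mukaiExpMap C x) = mukaiExpMap (B + C) x := by
  obtain ⟨l, r, s⟩ := x
  obtain ⟨m, hm⟩ := k3Form_even B
  obtain ⟨n, hn⟩ := k3Form_even C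
  have h1 : k3Form B B / 2 = m := by omega
  have h2 : k3Form C C / 2 = n := by omega
  have h3 : k3Form (B + C) (B + C) / 2 = m + n + k3Form B C := by
    have : k3Form (B + C) (B + C) = 2 * (m + n + k3Form B C) := by
      simp only [map_add, LinearMap.add_apply, hm, hn, k3Form_comm C B]; ring
    omega
  simp only [mukaiExpMap, h1, h2, h3, Prod.mk.injEq, true_and]
  refine ⟨by rw [smul_add]; abel, ?_⟩
  simp only [map_add, LinearMap.add_apply, map_smul, smul_eq_mul]
  ring

/-- The homomorphism `B ↦ exp(B)` from `Λ` to the automorphisms of `Λ̃`. -/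
def mukaiExp : Multiplicative K3Lattice →* (MukaiLattice ≃ₗ[ℤ] MukaiLattice) where
  toFun B :=
    { toFun := mukaiExpMap B.toAdd
      invFun := mukaiExpMap (-B.toAdd)
      map_add' := fun x y => by
        simp [mukaiExpMap, add_smul]
        constructor
        · abel
        · ring
      map_smul' := fun c x => by
        simp only [mukaiExpMap, Prod.smul_fst, Prod.smul_snd, Prod.smul_mk, Prod.mk.injEq,
          map_smul, smul_eq_mul, smul_add, mul_smul, RingHom.id_apply, true_and]
        ring
      left_inv := fun x => by
        rw [mukaiExpMap_comp, neg_add_cancel, mukaiExpMap_zero]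
      right_inv := fun x => by
        rw [mukaiExpMap_comp, add_neg_cancel, mukaiExpMap_zero] }
  map_one' := LinearEquiv.ext mukaiExpMap_zero
  map_mul' B C := LinearEquiv.ext fun x => (mukaiExpMap_comp B.toAdd C.toAdd x).symm

/-- The subgroup `O₊(Λ)` of `O₊(Λ̃)`. -/
def subOplusK3 : Subgroup (MukaiLattice ≃ₗ[ℤ] MukaiLattice) := OplusK3.map extendK3

/-- The subgroup `O₊(U)` of `O₊(Λ̃)`. -/
def subOplusHyp : Subgroup (MukaiLattice ≃ₗ[ℤ] MukaiLattice) := OplusHyp.map extendHyp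

/-- The subgroup `exp(Λ)` of `O₊(Λ̃)`. -/
def subExp : Subgroup (MukaiLattice ≃ₗ[ℤ] MukaiLattice) := mukaiExp.range

/-! ## Period domains -/

/-- Complex conjugation on `Γ_ℂ = ℂ ⊗ Γ`. -/
def latticeConj (Γ : Type) [AddCommGroup Γ] : ℂ ⊗[ℤ] Γ →ₗ[ℤ] ℂ ⊗[ℤ] Γ :=
  LinearMap.rTensor Γ (starRingEnd ℂ).toAddMonoidHom.toIntLinearMap

/-- `x` spans a point of the K3 period domain: `x² = 0` and `(x, x̄) > 0` (with `ℂ`-bilinear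
extension of the intersection form; `(x, x̄)` is automatically real). -/
def IsPeriodVector (x : ℂ ⊗[ℤ] K3Lattice) : Prop :=
  k3Form.baseChange ℂ x x = 0 ∧ 0 < (k3Form.baseChange ℂ x (latticeConj K3Lattice x)).re

/-- The K3 surface period domain `Q ⊂ ℙ(Λ_ℂ)`. -/
def periodDomain : Set (ℙ ℂ (ℂ ⊗[ℤ] K3Lattice)) :=
  {p | ∃ (x : ℂ ⊗[ℤ] K3Lattice) (hx : x ≠ 0), p = Projectivization.mk ℂ x hx ∧ IsPeriodVector x}

/-- The algebraic periods `Q_alg ⊂ Q`: those `x` for which there is an integral class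
`B ∈ x^⊥ ∩ Λ` with `B² > 0`. -/
def algPeriodDomain : Set (ℙ ℂ (ℂ ⊗[ℤ] K3Lattice)) :=
  {p | ∃ (x : ℂ ⊗[ℤ] K3Lattice) (hx : x ≠ 0), p = Projectivization.mk ℂ x hx ∧ IsPeriodVector x ∧
    ∃ B : K3Lattice, k3Form.baseChange ℂ x (1 ⊗ₜ B) = 0 ∧ 0 < k3Form B B}

theorem inl_baseChange_injective :
    Function.Injective ((LinearMap.inl ℤ K3Lattice HypPlane).baseChange ℂ) := by
  refine Function.LeftInverse.injective
    (g := (LinearMap.fst ℤ K3Lattice HypPlane).baseChange ℂ) fun x => ?_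
  rw [← LinearMap.comp_apply, ← LinearMap.baseChange_comp, LinearMap.fst_comp_inl,
    LinearMap.baseChange_id, LinearMap.id_apply]

/-- The embedding `ℙ(Λ_ℂ) ⊂ ℙ(Λ̃_ℂ)` induced by `Λ ⊂ Λ̃`. -/
def projInclusion : ℙ ℂ (ℂ ⊗[ℤ] K3Lattice) → ℙ ℂ (ℂ ⊗[ℤ] MukaiLattice) :=
  Projectivization.map ((LinearMap.inl ℤ K3Lattice HypPlane).baseChange ℂ)
    inl_baseChange_injective

/-- The action of an automorphism of `Λ̃` on `ℙ(Λ̃_ℂ)`. -/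
def projAction (g : MukaiLattice ≃ₗ[ℤ] MukaiLattice) :
    ℙ ℂ (ℂ ⊗[ℤ] MukaiLattice) → ℙ ℂ (ℂ ⊗[ℤ] MukaiLattice) :=
  Projectivization.map (g.baseChange ℤ ℂ MukaiLattice MukaiLattice).toLinearMap
    (g.baseChange ℤ ℂ MukaiLattice MukaiLattice).injective

/-- `H = {g ∈ O₊(Λ̃) | g(Q) ∩ Q ≠ ∅}`. -/
def periodMeetingSet : Set (MukaiLattice ≃ₗ[ℤ] MukaiLattice) :=
  {g | g ∈ OplusMukai ∧
    (projAction g '' (projInclusion '' periodDomain) ∩ projInclusion '' periodDomain).Nonempty}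

/-- `H_alg = {g ∈ O₊(Λ̃) | g(Q_alg) ∩ Q_alg ≠ ∅}`. -/
def algPeriodMeetingSet : Set (MukaiLattice ≃ₗ[ℤ] MukaiLattice) :=
  {g | g ∈ OplusMukai ∧
    (projAction g '' (projInclusion '' algPeriodDomain) ∩
      projInclusion '' algPeriodDomain).Nonempty}

end

/-!
An orientation of the positive directions is controlled by a diagonalization of the form
(`SignatureFrame`). If `v`, `w` are positive frames and `p` is the reference frame, the sign of
`det b(vᵢ, wⱼ)` is the product of the signs of `det b(vᵢ, pⱼ)` and `det b(wᵢ, pⱼ)`: contracting the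
negative coordinates of `v` and `w` to zero is a path along which the determinant does not vanish.
Hence an isometry `g` preserves the orientation if and only if `det b(g pᵢ, pⱼ) > 0`
(`SignatureFrame.mem_orientedIsometryGroup_iff`), and with this test `O₊(Λ)`, `O₊(U)` and `exp(Λ)`
are seen to lie in `O₊(Λ̃)`.

The group `G` generated by them is all of `O₊(Λ̃)` (`mukaiGenerated_eq`). It contains the isometries
`mukaiCoexp B`, conjugate to `exp(B)` by `(r, s) ↦ (-s, -r)`. An isotropic vector `(r, l, s)` with
`r ≠ 0` is moved by `G` into `H⁰`: if an isotropic `B`, pairing to `1` with some vector, has a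
pairing with `l` that is not divisible by `r`, then `exp` reduces this pairing modulo `r` and
`mukaiCoexp (± B)` makes `|r|` smaller; otherwise `l ∈ rΛ`, and `exp(-l/r)` kills `l`. Thus, for
`g ∈ O₊(Λ̃)`, some `γ ∈ G` takes `g(1, 0, 0)` to `±(1, 0, 0)`, where the sign can be corrected in
`G`. After a further `mukaiCoexp` the isometry fixes `U` and so comes from `O₊(Λ)`.

The complement of any `B ∈ Λ` contains an algebraic period, already in the span of three orthogonal
positive classes (`exists_isPeriodVector_orthogonal`), and `exp(B)` fixes the periods orthogonal to
`B`; so `exp(Λ)`, like `O₊(Λ)` and `O₊(U)`, lies in `H_alg`. On the other hand, if `g` takes a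
period `x` into `Λ_ℂ`, then `x` is orthogonal to the projection of `g⁻¹(U)` to `Λ`. For a suitable
product `g⁻¹` of a `mukaiCoexp` and an `exp` this projection is a positive plane, and `Λ`, with only three positive
directions, has no period orthogonal to it. So `H` is not everything, and then `H` and `H_alg`,
which generate `O₊(Λ̃)`, are not subgroups.
-/

/-! ### Orientations of positive spaces -/

/-- The matrix form of the cocycle rule for orientations. The rows of `X₁, Y₁` and of `X₂, Y₂` are
the coordinates of two frames, for the quadratic form with weights `1/2` on the `X`-coordinates and
`-a/4` on the `Y`-coordinates; both frames span positive subspaces. -/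
theorem det_gram_mul_det_mul_det_pos {k : ℕ} {κ : Type} [Fintype κ] (a : κ → ℝ) (ha : ∀ i, 0 ≤ a i)
    (X₁ X₂ : Matrix (Fin k) (Fin k) ℝ) (Y₁ Y₂ : Matrix (Fin k) κ ℝ)
    (h₁ : ∀ c : Fin k → ℝ, c ≠ 0 →
      ∑ l, a l * (Matrix.vecMul c Y₁ l) ^ 2 < 2 * ∑ i, (Matrix.vecMul c X₁ i) ^ 2)
    (h₂ : ∀ c : Fin k → ℝ, c ≠ 0 →
      ∑ l, a l * (Matrix.vecMul c Y₂ l) ^ 2 < 2 * ∑ i, (Matrix.vecMul c X₂ i) ^ 2)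
    (G : Matrix (Fin k) (Fin k) ℝ)
    (hG : ∀ i j, 4 * G i j = 2 * ∑ l, X₁ i l * X₂ j l - ∑ l, a l * (Y₁ i l * Y₂ j l)) :
    0 < G.det * X₁.det * X₂.det := by
  have hX : ∀ (X : Matrix (Fin k) (Fin k) ℝ) (Y : Matrix (Fin k) κ ℝ),
      (∀ c : Fin k → ℝ, c ≠ 0 →
        ∑ l, a l * (Matrix.vecMul c Y l) ^ 2 < 2 * ∑ i, (Matrix.vecMul c X i) ^ 2) →
      X.det ≠ 0 := by
    intro X Y h h0
    obtain ⟨c, hc, hc0⟩ := Matrix.exists_vecMul_eq_zero_iff.mpr h0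
    have := h c hc
    rw [hc0] at this
    simp only [Pi.zero_apply, ne_eq, OfNat.ofNat_ne_zero, not_false_eq_true, zero_pow,
      Finset.sum_const_zero, mul_zero] at this
    exact absurd this (not_lt.mpr (Finset.sum_nonneg fun l _ => mul_nonneg (ha l) (sq_nonneg _)))
  have hd₁ := hX X₁ Y₁ h₁
  have hd₂ := hX X₂ Y₂ h₂
  classical
  -- Contract the negative coordinates to zero: the Gram matrix stays invertible on the way.
  let M : ℝ → Matrix (Fin k) (Fin k) ℝ := fun s =>
    (2 : ℝ) • (X₁ * X₂.transpose) - s • (Y₁ * Matrix.diagonal a * Y₂.transpose)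
  have hM1 : M 1 = (4 : ℝ) • G := by
    ext i j
    rw [Matrix.smul_apply, smul_eq_mul, hG]
    simp only [M, Matrix.sub_apply, Matrix.smul_apply, Matrix.mul_apply (N := X₂.transpose),
      Matrix.mul_apply (N := Y₂.transpose), Matrix.mul_diagonal, Matrix.transpose_apply,
      smul_eq_mul, one_mul]
    congr 1
    exact Finset.sum_congr rfl fun l _ => by ring
  have hne : ∀ s ∈ Set.Icc (0 : ℝ) 1, (M s).det ≠ 0 := by
    rintro s ⟨hs0, hs1⟩ h0
    obtain ⟨c, hc, hc0⟩ := Matrix.exists_vecMul_eq_zero_iff.mpr h0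
    -- `d` has the same positive coordinates in the second frame as `c` has in the first.
    let d : Fin k → ℝ := Matrix.vecMul (Matrix.vecMul c X₁) X₂⁻¹
    have hd : Matrix.vecMul d X₂ = Matrix.vecMul c X₁ := by
      simp only [d, Matrix.vecMul_vecMul]
      rw [Matrix.mul_assoc, Matrix.nonsing_inv_mul _ (isUnit_iff_ne_zero.mpr hd₂), Matrix.mul_one]
    have hd0 : d ≠ 0 := by
      intro hd0
      rw [hd0, Matrix.zero_vecMul] at hd
      have h0 := (h₁ c hc)
      rw [← hd] at h0
      simp only [Pi.zero_apply, ne_eq, OfNat.ofNat_ne_zero, not_false_eq_true, zero_pow,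
        Finset.sum_const_zero, mul_zero] at h0
      exact absurd h0 (not_lt.mpr (Finset.sum_nonneg fun l _ => mul_nonneg (ha l) (sq_nonneg _)))
    have key : (0 : ℝ) = 2 * ∑ i, (Matrix.vecMul c X₁ i) ^ 2 -
        s * ∑ l, a l * (Matrix.vecMul c Y₁ l * Matrix.vecMul d Y₂ l) := by
      have h1 : Matrix.vecMul c (M s) ⬝ᵥ d = 0 := by rw [hc0, zero_dotProduct]
      rw [← h1]
      simp only [M, Matrix.vecMul_sub, Matrix.vecMul_smul, sub_dotProduct, smul_dotProduct,
        smul_eq_mul, ← Matrix.vecMul_vecMul]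
      rw [← Matrix.dotProduct_mulVec _ X₂.transpose, Matrix.mulVec_transpose, hd,
        ← Matrix.dotProduct_mulVec _ Y₂.transpose, Matrix.mulVec_transpose]
      simp only [dotProduct, Matrix.vecMul_diagonal]
      congr 2
      · exact Finset.sum_congr rfl fun l _ => by ring
      · exact Finset.sum_congr rfl fun l _ => by ring
    have i1 := h₁ c hc
    have i2 := h₂ d hd0
    rw [hd] at i2
    set q := ∑ i, (Matrix.vecMul c X₁ i) ^ 2
    have i3 : 2 * ∑ l, a l * (Matrix.vecMul c Y₁ l * Matrix.vecMul d Y₂ l) ≤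
        ∑ l, a l * (Matrix.vecMul c Y₁ l) ^ 2 + ∑ l, a l * (Matrix.vecMul d Y₂ l) ^ 2 := by
      rw [← Finset.sum_add_distrib, Finset.mul_sum]
      refine Finset.sum_le_sum fun l _ => ?_
      nlinarith [mul_nonneg (ha l) (sq_nonneg (Matrix.vecMul c Y₁ l - Matrix.vecMul d Y₂ l))]
    have hq : 0 ≤ q := Finset.sum_nonneg fun i _ => sq_nonneg _
    set p := ∑ l, a l * (Matrix.vecMul c Y₁ l * Matrix.vecMul d Y₂ l)
    have hp : p < 2 * q := by linarith
    have hq' : 0 < q := by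
      have : 0 ≤ ∑ l, a l * (Matrix.vecMul c Y₁ l) ^ 2 :=
        Finset.sum_nonneg fun l _ => mul_nonneg (ha l) (sq_nonneg _)
      linarith
    rcases le_or_gt p 0 with hp0 | hp0
    · nlinarith
    · nlinarith
  have hcont : Continuous fun s => (M s).det := by
    refine Continuous.matrix_det ?_
    fun_prop
  have h0 : (M 0).det = 2 ^ k * (X₁.det * X₂.det) := by
    simp [M]
  have h1 : (M 1).det = 4 ^ k * G.det := by
    rw [hM1, Matrix.det_smul, Fintype.card_fin]
  have hsame : 0 < (M 0).det * (M 1).det := by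
    have m0 := hne 0 (by simp)
    have m1 := hne 1 (by simp)
    by_contra hcon
    rcases lt_or_gt_of_ne m0 with n0 | n0 <;> rcases lt_or_gt_of_ne m1 with n1 | n1
    · exact hcon (mul_pos_of_neg_of_neg n0 n1)
    · obtain ⟨s, hs, hs0⟩ := intermediate_value_Icc zero_le_one hcont.continuousOn ⟨n0.le, n1.le⟩
      exact hne s hs hs0
    · obtain ⟨s, hs, hs0⟩ := intermediate_value_Icc' zero_le_one hcont.continuousOn ⟨n1.le, n0.le⟩
      exact hne s hs hs0
    · exact hcon (mul_pos n0 n1)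
  rw [h0, h1] at hsame
  have : (0 : ℝ) < 2 ^ k * 4 ^ k := by positivity
  refine pos_of_mul_pos_right (a := (2 : ℝ) ^ k * 4 ^ k) ?_ this.le
  calc (0 : ℝ) < _ := hsame
    _ = _ := by ring

/-- A diagonalization of an integral form: an orthogonal family of `k` vectors of square `2`,
completed to a decomposition of `b` by vectors `neg i` that contribute negatively. It exhibits `b`
as a form with exactly `k` positive directions. The expansion is multiplied by `4` to stay
integral. -/
structure SignatureFrame {Γ : Type} [AddCommGroup Γ] (b : LinearMap.BilinForm ℤ Γ) (k : ℕ)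
    (κ : Type) [Fintype κ] where
  /-- the positive directions -/
  pos : Fin k → Γ
  /-- the negative directions -/
  neg : κ → Γ
  /-- the weights of the negative directions -/
  weight : κ → ℕ
  pos_pos : ∀ i j, b (pos i) (pos j) = if i = j then 2 else 0
  expansion : ∀ x y, 4 * b x y = 2 * ∑ i, b x (pos i) * b y (pos i) -
    ∑ i, weight i * (b x (neg i) * b y (neg i))

section BaseChange

variable {Γ : Type} [AddCommGroup Γ] {b : LinearMap.BilinForm ℤ Γ} {k : ℕ} {κ : Type} [Fintype κ]

theorem SignatureFrame.expansion_baseChange (S : SignatureFrame b k κ) (A : Type) [CommRing A]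
    (x y : A ⊗[ℤ] Γ) :
    4 * b.baseChange A x y =
      2 * ∑ i, b.baseChange A x (1 ⊗ₜ S.pos i) * b.baseChange A y (1 ⊗ₜ S.pos i) -
      ∑ i, S.weight i * (b.baseChange A x (1 ⊗ₜ S.neg i) * b.baseChange A y (1 ⊗ₜ S.neg i)) := by
  induction x with
  | zero => simp
  | add x x' hx hx' =>
    simp only [map_add, LinearMap.add_apply, mul_add, add_mul, Finset.sum_add_distrib, hx, hx']
    ring
  | tmul a m =>
    induction y with
    | zero => simp
    | add y y' hy hy' =>
      simp only [map_add, LinearMap.add_apply, mul_add, Finset.sum_add_distrib, hy, hy']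
      ring
    | tmul a' m' =>
      have h := congrArg (Int.cast : ℤ → A) (S.expansion m m')
      push_cast at h
      simp only [LinearMap.BilinForm.baseChange_tmul, zsmul_eq_mul, mul_one]
      calc _ = a * a' * (4 * ((b m m' : ℤ) : A)) := by ring
        _ = _ := by
          rw [h, mul_sub, Finset.mul_sum, Finset.mul_sum, Finset.mul_sum, Finset.mul_sum]
          congr 1 <;> exact Finset.sum_congr rfl fun l _ => by ring

theorem baseChange_apply_isometry (A : Type) [CommRing A] {g : Γ ≃ₗ[ℤ] Γ}
    (hg : g ∈ isometryGroup b) (x y : A ⊗[ℤ] Γ) :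
    b.baseChange A (g.baseChange ℤ A Γ Γ x) (g.baseChange ℤ A Γ Γ y) = b.baseChange A x y := by
  induction x with
  | zero => simp
  | add x x' hx hx' => simp only [map_add, LinearMap.add_apply, hx, hx']
  | tmul a m =>
    induction y with
    | zero => simp
    | add y y' hy hy' => simp only [map_add, hy, hy']
    | tmul a' m' =>
      rw [LinearEquiv.baseChange_tmul, LinearEquiv.baseChange_tmul,
        LinearMap.BilinForm.baseChange_tmul, LinearMap.BilinForm.baseChange_tmul, hg m m']

/-- The pairings of a frame with the positive directions of the diagonalization. The sign of the
determinant compares the orientation of the frame with that of `S.pos`. -/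
def SignatureFrame.posMatrix (S : SignatureFrame b k κ) (v : Fin k → ℝ ⊗[ℤ] Γ) :
    Matrix (Fin k) (Fin k) ℝ :=
  Matrix.of fun i j => b.baseChange ℝ (v i) (1 ⊗ₜ S.pos j)

theorem SignatureFrame.lt_of_isPositiveFrame (S : SignatureFrame b k κ) {v : Fin k → ℝ ⊗[ℤ] Γ}
    (hv : IsPositiveFrame b v) (c : Fin k → ℝ) (hc : c ≠ 0) :
    ∑ l, (S.weight l : ℝ) *
      (Matrix.vecMul c (Matrix.of fun i j => b.baseChange ℝ (v i) (1 ⊗ₜ S.neg j)) l) ^ 2 <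
      2 * ∑ i, (Matrix.vecMul c (S.posMatrix v) i) ^ 2 := by
  have h := hv.dotProduct_mulVec_pos hc
  have e : star c ⬝ᵥ (Matrix.of fun i j => b.baseChange ℝ (v i) (v j)).mulVec c =
      b.baseChange ℝ (∑ i, c i • v i) (∑ i, c i • v i) := by
    simp only [dotProduct, Matrix.mulVec, Matrix.of_apply, star_trivial, map_sum,
      LinearMap.sum_apply, map_smul, LinearMap.smul_apply, smul_eq_mul, Finset.mul_sum]
    rw [Finset.sum_comm]
    exact Finset.sum_congr rfl fun i _ => Finset.sum_congr rfl fun j _ => by ring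
  have f : ∀ m : Γ, ∑ i, c i * b.baseChange ℝ (v i) (1 ⊗ₜ m) =
      b.baseChange ℝ (∑ i, c i • v i) (1 ⊗ₜ m) := by
    intro m
    simp only [map_sum, LinearMap.sum_apply, map_smul, LinearMap.smul_apply, smul_eq_mul]
  have g := S.expansion_baseChange ℝ (∑ i, c i • v i) (∑ i, c i • v i)
  rw [e] at h
  simp only [Matrix.vecMul, dotProduct, SignatureFrame.posMatrix, Matrix.of_apply, f, sq]
  linarith

/-- The sign of the projection from one positive space to another is the product of the signs of
their frames relative to the reference frame `S.pos`, and none of these signs vanishes. -/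
theorem SignatureFrame.det_mul_det_mul_det_pos (S : SignatureFrame b k κ)
    {v w : Fin k → ℝ ⊗[ℤ] Γ} (hv : IsPositiveFrame b v) (hw : IsPositiveFrame b w) :
    0 < (Matrix.of fun i j => b.baseChange ℝ (v i) (w j)).det *
      (S.posMatrix v).det * (S.posMatrix w).det :=
  det_gram_mul_det_mul_det_pos (fun i => (S.weight i : ℝ)) (fun _ => Nat.cast_nonneg _) _ _
    (Matrix.of fun i j => b.baseChange ℝ (v i) (1 ⊗ₜ S.neg j))
    (Matrix.of fun i j => b.baseChange ℝ (w i) (1 ⊗ₜ S.neg j))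
    (S.lt_of_isPositiveFrame hv) (S.lt_of_isPositiveFrame hw) _
    (fun i j => S.expansion_baseChange ℝ (v i) (w j))

theorem SignatureFrame.isPositiveFrame_pos (S : SignatureFrame b k κ) :
    IsPositiveFrame b fun i => (1 : ℝ) ⊗ₜ[ℤ] S.pos i := by
  have : (Matrix.of fun i j => b.baseChange ℝ ((1 : ℝ) ⊗ₜ[ℤ] S.pos i) (1 ⊗ₜ S.pos j)) =
      Matrix.diagonal fun _ => (2 : ℝ) := by
    ext i j
    simp only [Matrix.of_apply, LinearMap.BilinForm.baseChange_tmul, S.pos_pos,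
      Matrix.diagonal_apply]
    split_ifs <;> simp
  rw [IsPositiveFrame, this, Matrix.posDef_diagonal_iff]
  exact fun _ => two_pos

/-- Whether an isometry preserves the orientation can be tested on the reference frame. -/
theorem SignatureFrame.mem_orientedIsometryGroup_iff (S : SignatureFrame b k κ)
    {g : Γ ≃ₗ[ℤ] Γ} (hg : g ∈ isometryGroup b) :
    g ∈ orientedIsometryGroup b k ↔
      0 < (Matrix.of fun i j => b (g (S.pos i)) (S.pos j)).det := by
  let w : Fin k → ℝ ⊗[ℤ] Γ := fun i => 1 ⊗ₜ S.pos i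
  let gv : (Fin k → ℝ ⊗[ℤ] Γ) → Fin k → ℝ ⊗[ℤ] Γ := fun v i => g.baseChange ℤ ℝ Γ Γ (v i)
  have hw : IsPositiveFrame b w := S.isPositiveFrame_pos
  have hdet : (S.posMatrix (gv w)).det =
      ((Matrix.of fun i j => b (g (S.pos i)) (S.pos j)).det : ℤ) := by
    rw [Int.cast_det]
    congr 1
    ext i j
    simp [SignatureFrame.posMatrix, gv, w]
  have hsgn : ∀ v, IsPositiveFrame b v → 0 < (S.posMatrix v).det * (S.posMatrix (gv v)).det *
      (S.posMatrix (gv w)).det := by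
    intro v hv
    have := S.det_mul_det_mul_det_pos (isPositiveFrame_baseChange hg hv)
      (isPositiveFrame_baseChange hg hw)
    simp only [baseChange_isometry hg] at this
    exact this
  have hproj : ∀ v u, IsPositiveFrame b v → IsPositiveFrame b u →
      (ProjectsOrientedly b v u ↔ 0 < (S.posMatrix v).det * (S.posMatrix u).det) := by
    intro v u hv hu
    have h := S.det_mul_det_mul_det_pos hv hu
    rw [mul_assoc] at h
    exact pos_iff_pos_of_mul_pos h
  have hww : 0 < (S.posMatrix w).det := hw.det_pos
  rw [← Int.cast_pos (R := ℝ), ← hdet]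
  constructor
  · intro h
    have := (h.2 w w hw hw).mp ((hproj w w hw hw).mpr (mul_pos hww hww))
    rw [hproj _ _ (isPositiveFrame_baseChange hg hw) hw] at this
    exact pos_of_mul_pos_left this hww.le
  · intro h
    refine ⟨hg, fun v u hv hu => ?_⟩
    rw [hproj v u hv hu, hproj _ u (isPositiveFrame_baseChange hg hv) hu]
    have h1 : 0 < (S.posMatrix v).det * (S.posMatrix (gv v)).det :=
      pos_of_mul_pos_left (hsgn v hv) h.le
    rcases eq_or_ne (S.posMatrix u).det 0 with h0 | h0
    · simp [h0]
    · refine pos_iff_pos_of_mul_pos ?_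
      rw [mul_mul_mul_comm]
      exact mul_pos h1 (mul_self_pos.mpr h0)

end BaseChange

/-! ### Diagonalizations of the K3 lattice, the hyperbolic plane and the Mukai lattice -/

/-- The bilinear form of the root lattice `E₈` in the basis of simple roots. -/
def e8Form : LinearMap.BilinForm ℤ (Fin 8 → ℤ) := Matrix.toBilin' CartanMatrix.E₈

/-- The inclusion of the `i`-th copy of `-E₈` into the K3 lattice. -/
def e8Vec (i : Fin 2) (u : Fin 8 → ℤ) : K3Lattice :=
  Sum.elim (fun p => if p.1 = i then u p.2 else 0) 0

/-- The inclusion of the `i`-th hyperbolic plane into the K3 lattice. -/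
def hypVec (i : Fin 3) (a b : ℤ) : K3Lattice :=
  Sum.elim 0 (fun p => if p.1 = i then ![a, b] p.2 else 0)

theorem e8Vec_inr (i : Fin 2) (u : Fin 8 → ℤ) (p : Fin 3 × Fin 2) : e8Vec i u (.inr p) = 0 := rfl

theorem hypVec_inr (i : Fin 3) (a b : ℤ) (p : Fin 3 × Fin 2) :
    hypVec i a b (.inr p) = if p.1 = i then ![a, b] p.2 else 0 := rfl

theorem k3Form_eq (x y : K3Lattice) :
    k3Form x y =
      (-∑ i, e8Form (fun j => x (.inl (i, j))) (fun j => y (.inl (i, j)))) +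
      ∑ i, (x (.inr (i, 0)) * y (.inr (i, 1)) + x (.inr (i, 1)) * y (.inr (i, 0))) := by
  simp only [k3Form_apply, e8Form, Matrix.toBilin'_apply, Fintype.sum_sum_type,
    Fintype.sum_prod_type, k3Gram, Matrix.fromBlocks_apply₁₁, Matrix.fromBlocks_apply₁₂,
    Matrix.fromBlocks_apply₂₁, Matrix.fromBlocks_apply₂₂, Matrix.kroneckerMap_apply,
    Matrix.zero_apply, mul_zero, zero_mul, Finset.sum_const_zero, add_zero, zero_add,
    Matrix.one_apply, Matrix.neg_apply, mul_neg, neg_mul, ite_mul, one_mul, mul_ite,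
    Finset.sum_neg_distrib]
  congr 1
  · congr 1
    refine Finset.sum_congr rfl fun i _ => Finset.sum_congr rfl fun j _ => ?_
    rw [Finset.sum_comm]
    simp
  · refine Finset.sum_congr rfl fun i _ => ?_
    simp [Fin.sum_univ_two, add_comm]

theorem k3Form_e8Vec (x : K3Lattice) (i : Fin 2) (u : Fin 8 → ℤ) :
    k3Form x (e8Vec i u) = -e8Form (fun j => x (.inl (i, j))) u := by
  rw [k3Form_eq]
  simp only [e8Vec, Sum.elim_inl, Sum.elim_inr, Pi.zero_apply, mul_zero, add_zero,
    Finset.sum_const_zero]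
  rw [Finset.sum_eq_single i]
  · simp
  · intro l _ hl
    simp only [hl, if_false]
    exact map_zero _
  · simp

theorem k3Form_hypVec (x : K3Lattice) (i : Fin 3) (a b : ℤ) :
    k3Form x (hypVec i a b) = x (.inr (i, 0)) * b + x (.inr (i, 1)) * a := by
  rw [k3Form_eq]
  simp only [hypVec, Sum.elim_inl, Sum.elim_inr, Pi.zero_apply]
  rw [Finset.sum_eq_single i]
  · have : ∀ l, e8Form (fun j => x (.inl (l, j))) (fun _ => 0) = 0 := fun l => map_zero _
    simp [this]
  · intro l _ hl
    simp [hl]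
  · simp

/-- In the usual coordinates of `ℝ⁸` the lattice `E₈` contains the orthogonal vectors `2εᵢ`; the
rows of this matrix express them by the simple roots. -/
def e8Orthogonal : Matrix (Fin 8) (Fin 8) ℤ :=
  !![0, 1, -1, 0, 0, 0, 0, 0;
    0, 1, 1, 0, 0, 0, 0, 0;
    0, 1, 1, 2, 0, 0, 0, 0;
    0, 1, 1, 2, 2, 0, 0, 0;
    0, 1, 1, 2, 2, 2, 0, 0;
    0, 1, 1, 2, 2, 2, 2, 0;
    0, 1, 1, 2, 2, 2, 2, 2;
    4, 5, 7, 10, 8, 6, 4, 2]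

theorem four_smul_E₈ : (4 : ℤ) • CartanMatrix.E₈ =
    (CartanMatrix.E₈ * e8Orthogonal.transpose) *
      (CartanMatrix.E₈ * e8Orthogonal.transpose).transpose := by
  decide +kernel

theorem four_mul_e8Form (u v : Fin 8 → ℤ) :
    4 * e8Form u v = ∑ k, e8Form u (e8Orthogonal k) * e8Form v (e8Orthogonal k) := by
  have h : ∀ u k, e8Form u (e8Orthogonal k) =
      Matrix.vecMul u (CartanMatrix.E₈ * e8Orthogonal.transpose) k := by
    intro u k
    rw [e8Form, Matrix.toBilin'_apply', Matrix.dotProduct_mulVec, ← Matrix.vecMul_vecMul]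
    rfl
  calc 4 * e8Form u v = u ⬝ᵥ ((4 : ℤ) • CartanMatrix.E₈).mulVec v := by
        rw [e8Form, Matrix.toBilin'_apply', Matrix.smul_mulVec, dotProduct_smul, smul_eq_mul]
    _ = _ := by
        rw [four_smul_E₈, ← Matrix.mulVec_mulVec, Matrix.dotProduct_mulVec,
          Matrix.mulVec_transpose]
        simp only [h, dotProduct]

/-- The diagonalization of the K3 lattice by `eᵢ + fᵢ`, `eᵢ - fᵢ` in the three hyperbolic planes
and the vectors `2εᵢ` in the two copies of `-E₈`. -/
def k3Frame : SignatureFrame k3Form 3 ((Fin 2 × Fin 8) ⊕ Fin 3) where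
  pos i := hypVec i 1 1
  neg := Sum.elim (fun p => e8Vec p.1 (e8Orthogonal p.2)) fun i => hypVec i 1 (-1)
  weight := Sum.elim 1 2
  pos_pos := by
    intro i j
    rw [k3Form_hypVec]
    rcases eq_or_ne i j with h | h
    · simp [hypVec, h]
    · simp [hypVec, h, h.symm]
  expansion := by
    intro x y
    rw [k3Form_eq]
    simp only [Fintype.sum_sum_type, Fintype.sum_prod_type, Sum.elim_inl, Sum.elim_inr,
      k3Form_e8Vec, k3Form_hypVec, Pi.ofNat_apply, neg_mul_neg, Nat.cast_one, one_mul,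
      ← four_mul_e8Form, Nat.cast_ofNat, Fin.sum_univ_three, Fin.sum_univ_two]
    ring

/-- The diagonalization of `U` by `(1, -1)` and `(1, 1)`. -/
def hypFrame : SignatureFrame hypForm 1 Unit where
  pos _ := (1, -1)
  neg _ := (1, 1)
  weight _ := 2
  pos_pos := by
    intro i j
    rw [if_pos (Subsingleton.elim _ _)]
    rfl
  expansion := by
    intro x y
    simp [hypForm]
    ring

theorem mukaiForm_apply (x y : MukaiLattice) :
    mukaiForm x y = k3Form x.1 y.1 + (-(x.2.1 * y.2.2) - x.2.2 * y.2.1) := rfl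

theorem mukaiForm_eq_add (x y : MukaiLattice) :
    mukaiForm x y = k3Form x.1 y.1 + hypForm x.2 y.2 := rfl

/-- The diagonalization of the Mukai lattice by those of `U` and of the K3 lattice. -/
def mukaiFrame : SignatureFrame mukaiForm 4 (((Fin 2 × Fin 8) ⊕ Fin 3) ⊕ Unit) where
  pos := Fin.cons (0, (1, -1)) fun i => (hypVec i 1 1, 0)
  neg := Sum.elim (fun i => (k3Frame.neg i, 0)) fun _ => (0, (1, 1))
  weight := Sum.elim k3Frame.weight fun _ => 2
  pos_pos := by
    intro i j
    refine Fin.cases ?_ (fun i => ?_) i <;> refine Fin.cases ?_ (fun j => ?_) j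
    · simp [mukaiForm_apply]
    · simp [mukaiForm_apply, (Fin.succ_ne_zero _).symm]
    · simp [mukaiForm_apply]
    · have : k3Form (hypVec i 1 1) (hypVec j 1 1) = if i = j then 2 else 0 := k3Frame.pos_pos i j
      simpa [mukaiForm_apply] using this
  expansion := by
    intro x y
    have h := k3Frame.expansion x.1 y.1
    have h' := hypFrame.expansion x.2 y.2
    rw [mukaiForm_eq_add, mul_add, h, h', Fin.sum_univ_succ (n := 3)]
    simp [mukaiForm_eq_add, hypFrame, k3Frame]
    ring

/-! ### The subgroups of the orthogonal group of the Mukai lattice -/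

theorem mem_OplusMukai_iff {g : MukaiLattice ≃ₗ[ℤ] MukaiLattice}
    (hg : g ∈ isometryGroup mukaiForm) :
    g ∈ OplusMukai ↔
      0 < (Matrix.of fun i j => mukaiForm (g (mukaiFrame.pos i)) (mukaiFrame.pos j)).det :=
  mukaiFrame.mem_orientedIsometryGroup_iff hg

theorem extendK3_apply (h : K3Lattice ≃ₗ[ℤ] K3Lattice) (x : MukaiLattice) :
    extendK3 h x = (h x.1, x.2) := rfl

theorem extendHyp_apply (h : HypPlane ≃ₗ[ℤ] HypPlane) (x : MukaiLattice) :
    extendHyp h x = (x.1, h x.2) := rfl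

theorem mukaiExp_apply (B : Multiplicative K3Lattice) (x : MukaiLattice) :
    mukaiExp B x = (x.1 + x.2.1 • B.toAdd,
      (x.2.1, x.2.2 + k3Form B.toAdd x.1 + x.2.1 * (k3Form B.toAdd B.toAdd / 2))) := rfl

theorem extendK3_mem_isometryGroup_iff {h : K3Lattice ≃ₗ[ℤ] K3Lattice} :
    extendK3 h ∈ isometryGroup mukaiForm ↔ h ∈ isometryGroup k3Form := by
  constructor
  · intro H x y
    have := H (x, 0) (y, 0)
    simpa [extendK3_apply, mukaiForm_apply] using this
  · intro H x y
    rw [extendK3_apply, extendK3_apply, mukaiForm_apply, mukaiForm_apply, H]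

theorem extendK3_mem_OplusMukai_iff {h : K3Lattice ≃ₗ[ℤ] K3Lattice} :
    extendK3 h ∈ OplusMukai ↔ h ∈ OplusK3 := by
  by_cases hh : h ∈ isometryGroup k3Form
  swap
  · exact iff_of_false (fun H => hh (extendK3_mem_isometryGroup_iff.mp H.1)) fun H => hh H.1
  rw [mem_OplusMukai_iff (extendK3_mem_isometryGroup_iff.mpr hh), OplusK3,
    k3Frame.mem_orientedIsometryGroup_iff hh, Matrix.det_succ_row_zero, Fin.sum_univ_succ,
    Finset.sum_eq_zero]
  · have e : (Matrix.of fun i j => mukaiForm (extendK3 h (mukaiFrame.pos i)) (mukaiFrame.pos j)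
        ).submatrix Fin.succ (Fin.succAbove 0) =
        Matrix.of fun i j => k3Form (h (k3Frame.pos i)) (k3Frame.pos j) := by
      ext i j
      simp [mukaiFrame, k3Frame, extendK3_apply, mukaiForm_apply]
    rw [e]
    simp [mukaiFrame, extendK3_apply, mukaiForm_apply]
  · intro j _
    simp [mukaiFrame, extendK3_apply, mukaiForm_apply]

theorem extendHyp_mem_OplusMukai {h : HypPlane ≃ₗ[ℤ] HypPlane} (hh : h ∈ OplusHyp) :
    extendHyp h ∈ OplusMukai := by
  have hi : extendHyp h ∈ isometryGroup mukaiForm := by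
    intro x y
    rw [extendHyp_apply, extendHyp_apply, mukaiForm_eq_add, mukaiForm_eq_add, hh.1]
  have h1 := (hypFrame.mem_orientedIsometryGroup_iff hh.1).mp hh
  rw [mem_OplusMukai_iff hi, Matrix.det_succ_row_zero, Fin.sum_univ_succ, Finset.sum_eq_zero]
  · have e : (Matrix.of fun i j => mukaiForm (extendHyp h (mukaiFrame.pos i)) (mukaiFrame.pos j)
        ).submatrix Fin.succ (Fin.succAbove 0) = Matrix.diagonal fun _ => 2 := by
      ext i j
      have := k3Frame.pos_pos i j
      simpa [mukaiFrame, k3Frame, extendHyp_apply, mukaiForm_apply, Matrix.diagonal_apply]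
        using this
    rw [e]
    simpa [mukaiFrame, hypFrame, extendHyp_apply, mukaiForm_eq_add] using h1
  · intro j _
    simp [mukaiFrame, extendHyp_apply, mukaiForm_eq_add]

theorem two_mul_half_k3Form (B : K3Lattice) : 2 * (k3Form B B / 2) = k3Form B B :=
  Int.mul_ediv_cancel' (even_iff_two_dvd.mp (k3Form_even B))

theorem mukaiExp_mem_isometryGroup (B : Multiplicative K3Lattice) :
    mukaiExp B ∈ isometryGroup mukaiForm := by
  intro x y
  have h := two_mul_half_k3Form B.toAdd
  simp only [mukaiExp_apply, mukaiForm_apply, map_add, map_smul, LinearMap.add_apply,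
    LinearMap.smul_apply, smul_eq_mul, k3Form_comm x.1 B.toAdd]
  linear_combination (-x.2.1 * y.2.1) * h

/-- The square of a class is at most the square of its projection to the positive directions. -/
theorem four_mul_k3Form_self_le (B : K3Lattice) :
    4 * k3Form B B ≤ 2 * ∑ i, k3Form B (hypVec i 1 1) ^ 2 := by
  rw [k3Frame.expansion]
  have : 0 ≤ ∑ i, k3Frame.weight i * (k3Form B (k3Frame.neg i) * k3Form B (k3Frame.neg i)) :=
    Finset.sum_nonneg fun i _ => mul_nonneg (Nat.cast_nonneg _) (mul_self_nonneg _)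
  simp only [sq]
  change 2 * ∑ i, k3Form B (hypVec i 1 1) * k3Form B (hypVec i 1 1) - _ ≤ _
  linarith

theorem mukaiExp_mem_OplusMukai (B : Multiplicative K3Lattice) : mukaiExp B ∈ OplusMukai := by
  rw [mem_OplusMukai_iff (mukaiExp_mem_isometryGroup B)]
  have h := two_mul_half_k3Form B.toAdd
  have h' := four_mul_k3Form_self_le B.toAdd
  set β : Fin 3 → ℤ := fun i => k3Form B.toAdd (hypVec i 1 1) with hβ
  set q := k3Form B.toAdd B.toAdd / 2
  have e : (Matrix.of fun i j => mukaiForm (mukaiExp B (mukaiFrame.pos i)) (mukaiFrame.pos j)) =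
      !![2 - q, β 0, β 1, β 2; -β 0, 2, 0, 0; -β 1, 0, 2, 0; -β 2, 0, 0, 2] := by
    have p : ∀ i j : Fin 3, k3Form (hypVec i 1 1) (hypVec j 1 1) = if i = j then 2 else 0 :=
      k3Frame.pos_pos
    ext i j
    refine Fin.cases ?_ (fun i => ?_) i <;> refine Fin.cases ?_ (fun j => ?_) j
    · simp [mukaiFrame, mukaiExp_apply, mukaiForm_apply]
      ring
    · simp [mukaiFrame, mukaiExp_apply, mukaiForm_apply]
      fin_cases j <;> rfl
    · simp [mukaiFrame, mukaiExp_apply, mukaiForm_apply]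
      fin_cases i <;> rfl
    · simp [mukaiFrame, mukaiExp_apply, mukaiForm_apply, p]
      fin_cases i <;> fin_cases j <;> rfl
  have d : (!![2 - q, β 0, β 1, β 2; -β 0, 2, 0, 0; -β 1, 0, 2, 0; -β 2, 0, 0, 2] :
      Matrix (Fin 4) (Fin 4) ℤ).det = 8 * (2 - q) + 4 * (β 0 ^ 2 + β 1 ^ 2 + β 2 ^ 2) := by
    simp [Matrix.det_succ_row_zero, Fin.sum_univ_succ, Fin.succAbove]
    ring
  rw [e, d]
  have h3 : ∑ i, k3Form B.toAdd (hypVec i 1 1) ^ 2 = β 0 ^ 2 + β 1 ^ 2 + β 2 ^ 2 :=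
    Fin.sum_univ_three _
  rw [h3] at h'
  nlinarith [sq_nonneg (β 0), sq_nonneg (β 1), sq_nonneg (β 2)]

/-! ### Generation of the orthogonal group of the Mukai lattice -/

/-- The isometry `(r, s) ↦ (-s, -r)` of `U`, which fixes the positive vector `(1, -1)`. -/
def hypNegSwap : HypPlane ≃ₗ[ℤ] HypPlane :=
  (LinearEquiv.prodComm ℤ ℤ ℤ).trans (LinearEquiv.neg ℤ)

theorem hypNegSwap_apply (x : HypPlane) : hypNegSwap x = (-x.2, -x.1) := rfl

theorem hypNegSwap_mem : hypNegSwap ∈ OplusHyp := by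
  have hi : hypNegSwap ∈ isometryGroup hypForm := by
    intro x y
    simp [hypNegSwap_apply, hypForm]
    ring
  rw [OplusHyp, hypFrame.mem_orientedIsometryGroup_iff hi, Matrix.det_unique]
  simp [hypFrame, hypNegSwap_apply, hypForm]

/-- The subgroup generated by `O₊(Λ)`, `O₊(U)` and `exp(Λ)`. -/
abbrev mukaiGenerated : Subgroup (MukaiLattice ≃ₗ[ℤ] MukaiLattice) :=
  subOplusK3 ⊔ subOplusHyp ⊔ subExp

theorem subOplusK3_le : subOplusK3 ≤ OplusMukai := by
  rintro _ ⟨h, hh, rfl⟩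
  exact extendK3_mem_OplusMukai_iff.mpr hh

theorem subOplusHyp_le : subOplusHyp ≤ OplusMukai := by
  rintro _ ⟨h, hh, rfl⟩
  exact extendHyp_mem_OplusMukai hh

theorem subExp_le : subExp ≤ OplusMukai := by
  rintro _ ⟨B, rfl⟩
  exact mukaiExp_mem_OplusMukai B

theorem mukaiGenerated_le : mukaiGenerated ≤ OplusMukai :=
  sup_le (sup_le subOplusK3_le subOplusHyp_le) subExp_le

/-- The isometry `exp(B)` with the two isotropic lines of `U` interchanged. -/
def mukaiCoexp (B : K3Lattice) : MukaiLattice ≃ₗ[ℤ] MukaiLattice :=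
  extendHyp hypNegSwap * mukaiExp (.ofAdd B) * extendHyp hypNegSwap

theorem extendHyp_hypNegSwap_mem : extendHyp hypNegSwap ∈ mukaiGenerated :=
  Subgroup.mem_sup_left (Subgroup.mem_sup_right ⟨_, hypNegSwap_mem, rfl⟩)

theorem mukaiExp_mem (B : Multiplicative K3Lattice) : mukaiExp B ∈ mukaiGenerated :=
  Subgroup.mem_sup_right ⟨B, rfl⟩

theorem mukaiCoexp_mem (B : K3Lattice) : mukaiCoexp B ∈ mukaiGenerated :=
  mul_mem (mul_mem extendHyp_hypNegSwap_mem (mukaiExp_mem _)) extendHyp_hypNegSwap_mem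

theorem mukaiCoexp_apply (B : K3Lattice) (x : MukaiLattice) :
    mukaiCoexp B x = (x.1 - x.2.2 • B,
      (x.2.1 - k3Form B x.1 + x.2.2 * (k3Form B B / 2), x.2.2)) := by
  simp only [mukaiCoexp, LinearEquiv.mul_apply, extendHyp_apply, hypNegSwap_apply, mukaiExp_apply,
    toAdd_ofAdd, Prod.mk.injEq, neg_smul, neg_neg, and_true]
  exact ⟨by abel, by ring⟩

/-- Since `Λ` is unimodular and spanned by isotropic vectors `B` that pair to `1` with some vector,
divisibility of a class can be tested on these `B`. In a copy of `-E₈` a root has square `-2`, and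
becomes isotropic after adding a vector of square `2` from a hyperbolic plane. -/
theorem exists_eq_smul_of_dvd_k3Form (r : ℤ) (l : K3Lattice)
    (h : ∀ B C : K3Lattice, k3Form B B = 0 → k3Form B C = 1 → r ∣ k3Form B l) :
    ∃ m, l = r • m := by
  have h1 : ∀ i, r ∣ l (.inr (i, 1)) := by
    intro i
    have := h (hypVec i 1 0) (hypVec i 0 1) (by simp [k3Form_hypVec, hypVec_inr])
      (by simp [k3Form_hypVec, hypVec_inr])
    rwa [k3Form_comm, k3Form_hypVec, mul_zero, zero_add, mul_one] at this
  have h0 : ∀ i, r ∣ l (.inr (i, 0)) := by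
    intro i
    have := h (hypVec i 0 1) (hypVec i 1 0) (by simp [k3Form_hypVec, hypVec_inr])
      (by simp [k3Form_hypVec, hypVec_inr])
    rwa [k3Form_comm, k3Form_hypVec, mul_zero, add_zero, mul_one] at this
  have h8 : ∀ i j, r ∣ Matrix.vecMul (fun j => l (.inl (i, j))) CartanMatrix.E₈ j := by
    intro i j
    have e1 : e8Form (Pi.single j 1) (Pi.single j 1) = 2 := by
      rw [e8Form, Matrix.toBilin'_single, CartanMatrix.E₈_diag]
    have e2 : (fun j' => e8Vec i (Pi.single j 1) (.inl (i, j'))) = Pi.single j 1 := by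
      simp [e8Vec]
    have e3 : (fun j' => hypVec 0 1 1 (.inl (i, j'))) = 0 := rfl
    have := h (e8Vec i (Pi.single j 1) + hypVec 0 1 1) (hypVec 0 1 0)
      (by
        simp only [map_add, LinearMap.add_apply, k3Form_e8Vec, e1, e2, e3, k3Form_hypVec, map_zero,
          LinearMap.zero_apply]
        simp [e8Vec_inr, hypVec_inr])
      (by simp [k3Form_hypVec, e8Vec_inr, hypVec_inr])
    rw [k3Form_comm, map_add, k3Form_e8Vec, k3Form_hypVec] at this
    have h' : r ∣ e8Form (fun j => l (.inl (i, j))) (Pi.single j 1) := by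
      refine (dvd_neg).mp ((dvd_add_left ?_).mp this)
      rw [mul_one, mul_one]
      exact dvd_add (h0 0) (h1 0)
    rwa [e8Form, Matrix.toBilin'_apply', Matrix.dotProduct_mulVec, dotProduct_single_one] at h'
  have h8' : ∀ i j, r ∣ l (.inl (i, j)) := by
    intro i j
    have e : Matrix.vecMul (Matrix.vecMul (fun j => l (.inl (i, j))) CartanMatrix.E₈)
        CartanMatrix.E₈⁻¹ = fun j => l (.inl (i, j)) := by
      rw [Matrix.vecMul_vecMul,
        Matrix.mul_nonsing_inv _ (by rw [CartanMatrix.E₈_det]; exact isUnit_one), Matrix.vecMul_one]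
    rw [← congrFun e j, Matrix.vecMul, dotProduct]
    exact Finset.dvd_sum fun k _ => Dvd.dvd.mul_right (h8 i k) _
  have hall : ∀ i, r ∣ l i := by
    rintro (⟨i, j⟩ | ⟨i, j⟩)
    · exact h8' i j
    · fin_cases j
      exacts [h0 i, h1 i]
  choose m hm using hall
  exact ⟨m, funext hm⟩

theorem exists_mem_mukaiGenerated_fst_ne_zero (z : MukaiLattice) (hz : z ≠ 0) :
    ∃ γ ∈ mukaiGenerated, (γ z).2.1 ≠ 0 := by
  rcases ne_or_eq z.2.1 0 with hr | hr
  · exact ⟨1, one_mem _, hr⟩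
  rcases ne_or_eq z.2.2 0 with hs | hs
  · exact ⟨_, extendHyp_hypNegSwap_mem, by simpa [extendHyp_apply, hypNegSwap_apply] using hs⟩
  have hl : ∃ B, k3Form B z.1 ≠ 0 := by
    by_contra! hcon
    obtain ⟨m, hm⟩ := exists_eq_smul_of_dvd_k3Form 0 z.1 fun B _ _ _ => by rw [hcon B]
    rw [zero_smul] at hm
    exact hz (Prod.ext hm (Prod.ext hr hs))
  obtain ⟨B, hB⟩ := hl
  refine ⟨_, mukaiCoexp_mem B, ?_⟩
  simpa [mukaiCoexp_apply, hr, hs] using hB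

/-- Euclidean descent on the coordinate in `H⁰`: an isotropic vector with `r ≠ 0` can be moved
into `H⁰`. -/
theorem exists_mem_mukaiGenerated_apply_eq (n : ℕ) : ∀ z : MukaiLattice, z.2.1.natAbs = n →
    z.2.1 ≠ 0 → mukaiForm z z = 0 → ∃ γ ∈ mukaiGenerated, ∃ r : ℤ, γ z = (0, (r, 0)) := by
  induction n using Nat.strong_induction_on with
  | _ n ih =>
  intro z hn hr hz
  by_cases hdiv : ∀ B C : K3Lattice, k3Form B B = 0 → k3Form B C = 1 → z.2.1 ∣ k3Form B z.1
  · obtain ⟨m, hm⟩ := exists_eq_smul_of_dvd_k3Form _ _ hdiv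
    refine ⟨_, mukaiExp_mem (.ofAdd (-m)), z.2.1, ?_⟩
    set x := mukaiExp (.ofAdd (-m)) z with hx
    have h1 : x.1 = 0 := by
      rw [hx, mukaiExp_apply, toAdd_ofAdd, smul_neg, ← hm, add_neg_cancel]
    have h2 : x.2.1 = z.2.1 := rfl
    have h3 : mukaiForm x x = 0 := by rw [hx, mukaiExp_mem_isometryGroup, hz]
    rw [mukaiForm_apply, h1, map_zero, h2] at h3
    have h4 : z.2.1 * x.2.2 = 0 := by linarith
    exact Prod.ext h1 (Prod.ext h2 ((mul_eq_zero.mp h4).resolve_left hr))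
  · push Not at hdiv
    obtain ⟨B, C, hB, hBC, hd⟩ := hdiv
    -- Reduce the pairing with `B` modulo `r`, then subtract the remainder from `r`.
    set r := z.2.1 with hrdef
    set q := k3Form B z.1 / r with hq
    set t := k3Form B z.1 % r with ht
    have ht0 : 0 < t := lt_of_le_of_ne (Int.emod_nonneg _ hr)
      fun h => hd (Int.dvd_of_emod_eq_zero h.symm)
    have ht1 : t < |r| := Int.emod_lt_abs _ hr
    have hqt : r * q + t = k3Form B z.1 := Int.mul_ediv_add_emod _ _
    obtain ⟨ε, hε0, hε⟩ : ∃ ε : ℤ, r - ε * t ≠ 0 ∧ (r - ε * t).natAbs < r.natAbs := by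
      rcases lt_or_gt_of_ne hr with h | h
      · rw [abs_of_neg h] at ht1
        exact ⟨-1, by omega, by omega⟩
      · rw [abs_of_pos h] at ht1
        exact ⟨1, by omega, by omega⟩
    set γ := mukaiCoexp (ε • B) * mukaiExp (.ofAdd (-q • C)) with hγ
    have hmem : γ ∈ mukaiGenerated := mul_mem (mukaiCoexp_mem _) (mukaiExp_mem _)
    have hval : (γ z).2.1 = r - ε * t := by
      simp only [hγ, LinearEquiv.mul_apply, mukaiCoexp_apply, mukaiExp_apply, map_smul, map_add,
        LinearMap.smul_apply, smul_eq_mul, hB, hBC, toAdd_ofAdd, ← hqt, ← hrdef]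
      simp
      ring
    obtain ⟨δ, hδ, r', hr'⟩ := ih (γ z).2.1.natAbs (by rw [hval, ← hn]; exact hε) (γ z) rfl
      (by rw [hval]; exact hε0) (by rw [(mukaiGenerated_le hmem).1, hz])
    exact ⟨δ * γ, mul_mem hδ hmem, r', hr'⟩

theorem exists_mem_mukaiGenerated_neg :
    ∃ γ ∈ mukaiGenerated, γ (0, (-1, 0)) = ((0, (1, 0)) : MukaiLattice) := by
  -- In `SL₂(ℤ)`, acting on a sum of two hyperbolic planes, the product of unipotents
  -- that equals minus a unipotent.
  refine ⟨mukaiExp (.ofAdd (hypVec 0 1 0)) * mukaiCoexp (hypVec 0 0 2) *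
    mukaiExp (.ofAdd (hypVec 0 1 0)),
    mul_mem (mul_mem (mukaiExp_mem _) (mukaiCoexp_mem _)) (mukaiExp_mem _), ?_⟩
  simp only [LinearEquiv.mul_apply, mukaiExp_apply, mukaiCoexp_apply, toAdd_ofAdd, k3Form_hypVec]
  simp [hypVec_inr, k3Form_hypVec]

/-- An isometry that fixes `U` pointwise is induced from the K3 lattice. -/
theorem mem_subOplusK3_of_fixes {g : MukaiLattice ≃ₗ[ℤ] MukaiLattice} (hg : g ∈ OplusMukai)
    (h0 : g (0, (1, 0)) = (0, (1, 0))) (h4 : g (0, (0, 1)) = (0, (0, 1))) : g ∈ subOplusK3 := by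
  have hU : ∀ u : HypPlane, g (0, u) = (0, u) := by
    intro u
    have : ((0, u) : MukaiLattice) = u.1 • (0, (1, 0)) + u.2 • (0, (0, 1)) := by
      simp
    rw [this, map_add, map_smul, map_smul, h0, h4]
  have hU' : ∀ u : HypPlane, g.symm (0, u) = (0, u) := fun u => by
    rw [LinearEquiv.symm_apply_eq, hU]
  have hsnd : ∀ x, (g x).2 = x.2 := by
    intro x
    have e1 := hg.1 x (0, (1, 0))
    have e2 := hg.1 x (0, (0, 1))
    rw [h0] at e1
    rw [h4] at e2
    simp only [mukaiForm_apply, map_zero] at e1 e2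
    exact Prod.ext (by linarith) (by linarith)
  have hsnd' : ∀ x, (g.symm x).2 = x.2 := fun x => by
    rw [← hsnd (g.symm x), LinearEquiv.apply_symm_apply]
  let h : K3Lattice ≃ₗ[ℤ] K3Lattice :=
    { toFun := fun l => (g (l, 0)).1
      invFun := fun l => (g.symm (l, 0)).1
      map_add' := fun l l' => by
        rw [← Prod.fst_add, ← map_add, Prod.mk_add_mk, add_zero]
      map_smul' := fun c l => by
        rw [RingHom.id_apply, ← Prod.smul_fst, ← map_smul, Prod.smul_mk, smul_zero]
      left_inv := fun l => by
        have : ((g (l, 0)).1, (0 : HypPlane)) = g (l, 0) := Prod.ext rfl (hsnd (l, 0)).symm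
        simp only [this, LinearEquiv.symm_apply_apply]
      right_inv := fun l => by
        have : ((g.symm (l, 0)).1, (0 : HypPlane)) = g.symm (l, 0) :=
          Prod.ext rfl (hsnd' (l, 0)).symm
        simp only [this, LinearEquiv.apply_symm_apply] }
  have hgh : extendK3 h = g := by
    ext1 x
    have : x = (x.1, 0) + (0, x.2) := by simp
    refine Prod.ext ?_ (hsnd x).symm
    conv_rhs => rw [this, map_add, hU, Prod.fst_add, add_zero]
    rfl
  exact ⟨h, extendK3_mem_OplusMukai_iff.mp (by rwa [hgh]), hgh⟩

/-- The subgroups `O₊(Λ)`, `O₊(U)` and `exp(Λ)` generate `O₊(Λ̃)`. -/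
theorem mukaiGenerated_eq : mukaiGenerated = OplusMukai := by
  refine le_antisymm mukaiGenerated_le fun g hg => ?_
  -- Move `g(1, 0, 0)` back to `(1, 0, 0)`.
  have step : ∃ γ ∈ mukaiGenerated, γ (g (0, (1, 0))) = (0, (1, 0)) := by
    have hne : g (0, (1, 0)) ≠ 0 := by
      rw [Ne, LinearEquiv.map_eq_zero_iff]
      simp
    obtain ⟨γ₁, hγ₁, h₁⟩ := exists_mem_mukaiGenerated_fst_ne_zero _ hne
    obtain ⟨γ₂, hγ₂, r, h₂⟩ := exists_mem_mukaiGenerated_apply_eq _ _ rfl h₁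
      (by rw [(mukaiGenerated_le hγ₁).1, hg.1]; simp [mukaiForm_apply])
    -- Unimodularity forces `r = ±1`.
    have hpair : mukaiForm (γ₂ (γ₁ (g (0, (1, 0))))) (γ₂ (γ₁ (g (0, (0, 1))))) = -1 := by
      rw [(mukaiGenerated_le hγ₂).1, (mukaiGenerated_le hγ₁).1, hg.1]
      simp [mukaiForm_apply]
    rw [h₂, mukaiForm_apply] at hpair
    have hr : r * (γ₂ (γ₁ (g (0, (0, 1))))).2.2 = 1 := by
      simp at hpair
      linarith
    rcases Int.eq_one_or_neg_one_of_mul_eq_one hr with rfl | rfl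
    · exact ⟨γ₂ * γ₁, mul_mem hγ₂ hγ₁, h₂⟩
    · obtain ⟨γ₃, hγ₃, h₃⟩ := exists_mem_mukaiGenerated_neg
      refine ⟨γ₃ * (γ₂ * γ₁), mul_mem hγ₃ (mul_mem hγ₂ hγ₁), ?_⟩
      rw [LinearEquiv.mul_apply, LinearEquiv.mul_apply, h₂, h₃]
  obtain ⟨γ, hγ, hγf⟩ := step
  have hg' : γ * g ∈ OplusMukai := mul_mem (mukaiGenerated_le hγ) hg
  set x := (γ * g) (0, (0, 1)) with hx
  have hx2 : x.2.2 = 1 := by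
    have := hg'.1 (0, (1, 0)) (0, (0, 1))
    rw [LinearEquiv.mul_apply, hγf, ← hx] at this
    simp [mukaiForm_apply] at this
    linarith
  have hc := mukaiCoexp_mem x.1
  have hmem : mukaiCoexp x.1 * (γ * g) ∈ OplusMukai := mul_mem (mukaiGenerated_le hc) hg'
  have hfix : mukaiCoexp x.1 * (γ * g) ∈ subOplusK3 := by
    refine mem_subOplusK3_of_fixes hmem ?_ ?_
    · rw [LinearEquiv.mul_apply, LinearEquiv.mul_apply, hγf, mukaiCoexp_apply]
      simp
    · have h0 := hmem.1 (0, (0, 1)) (0, (0, 1))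
      rw [LinearEquiv.mul_apply, ← hx] at h0 ⊢
      have e1 : (mukaiCoexp x.1 x).1 = 0 := by rw [mukaiCoexp_apply, hx2, one_smul, sub_self]
      have e2 : (mukaiCoexp x.1 x).2.2 = 1 := by rw [mukaiCoexp_apply, hx2]
      refine Prod.ext e1 (Prod.ext ?_ e2)
      simp only [mukaiForm_apply, e1, e2, map_zero] at h0
      change _ = (0 : ℤ)
      linarith
  have : g = γ⁻¹ * ((mukaiCoexp x.1)⁻¹ * (mukaiCoexp x.1 * (γ * g))) := by group
  rw [this]
  exact mul_mem (inv_mem hγ) (mul_mem (inv_mem hc)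
    (Subgroup.mem_sup_left (Subgroup.mem_sup_left hfix)))

/-! ### Period vectors -/

theorem latticeConj_tmul {Γ : Type} [AddCommGroup Γ] (a : ℂ) (m : Γ) :
    latticeConj Γ (a ⊗ₜ m) = (starRingEnd ℂ a) ⊗ₜ m := rfl

theorem latticeConj_baseChange {Γ : Type} [AddCommGroup Γ] (g : Γ ≃ₗ[ℤ] Γ) (x : ℂ ⊗[ℤ] Γ) :
    latticeConj Γ (g.baseChange ℤ ℂ Γ Γ x) = g.baseChange ℤ ℂ Γ Γ (latticeConj Γ x) := by
  induction x with
  | zero => simp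
  | add x y hx hy => simp only [map_add, hx, hy]
  | tmul a m => simp only [LinearEquiv.baseChange_tmul, latticeConj_tmul]

theorem baseChange_latticeConj {Γ : Type} [AddCommGroup Γ] (b : LinearMap.BilinForm ℤ Γ)
    (x : ℂ ⊗[ℤ] Γ) (m : Γ) :
    b.baseChange ℂ (latticeConj Γ x) (1 ⊗ₜ m) = starRingEnd ℂ (b.baseChange ℂ x (1 ⊗ₜ m)) := by
  induction x with
  | zero => simp
  | add x y hx hy => simp only [map_add, LinearMap.add_apply, hx, hy]
  | tmul a n =>
    simp only [latticeConj_tmul, LinearMap.BilinForm.baseChange_tmul, zsmul_eq_mul, map_mul,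
      mul_one, map_intCast]

theorem IsPeriodVector.ne_zero {x : ℂ ⊗[ℤ] K3Lattice} (hx : IsPeriodVector x) : x ≠ 0 := by
  rintro rfl
  simpa using hx.2

theorem IsPeriodVector.baseChange {h : K3Lattice ≃ₗ[ℤ] K3Lattice} (hh : h ∈ isometryGroup k3Form)
    {x : ℂ ⊗[ℤ] K3Lattice} (hx : IsPeriodVector x) :
    IsPeriodVector (h.baseChange ℤ ℂ K3Lattice K3Lattice x) := by
  rw [IsPeriodVector, latticeConj_baseChange, baseChange_apply_isometry ℂ hh,
    baseChange_apply_isometry ℂ hh]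
  exact hx

/-- The vector of `Λ_ℂ` with given coordinates along the three orthogonal positive directions. -/
def positiveVector (ζ : Fin 3 → ℂ) : ℂ ⊗[ℤ] K3Lattice := ∑ i, ζ i ⊗ₜ hypVec i 1 1

theorem latticeConj_positiveVector (ζ : Fin 3 → ℂ) :
    latticeConj K3Lattice (positiveVector ζ) = positiveVector fun i => starRingEnd ℂ (ζ i) := by
  simp only [positiveVector, map_sum, latticeConj_tmul]

theorem baseChange_positiveVector (ζ : Fin 3 → ℂ) (B : K3Lattice) :
    k3Form.baseChange ℂ (positiveVector ζ) (1 ⊗ₜ B) = ∑ i, ζ i * k3Form B (hypVec i 1 1) := by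
  simp only [positiveVector, map_sum, LinearMap.sum_apply, LinearMap.BilinForm.baseChange_tmul,
    zsmul_eq_mul, mul_one, k3Form_comm B]
  exact Finset.sum_congr rfl fun i _ => mul_comm _ _

theorem baseChange_positiveVector_positiveVector (ζ ξ : Fin 3 → ℂ) :
    k3Form.baseChange ℂ (positiveVector ζ) (positiveVector ξ) = 2 * ∑ i, ζ i * ξ i := by
  have p : ∀ i j : Fin 3, k3Form (hypVec i 1 1) (hypVec j 1 1) = if i = j then 2 else 0 :=
    k3Frame.pos_pos
  simp only [positiveVector, map_sum, LinearMap.sum_apply, LinearMap.BilinForm.baseChange_tmul, p]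
  simp [Finset.mul_sum]

theorem isPeriodVector_positiveVector {ζ : Fin 3 → ℂ} (h0 : ζ ≠ 0) (h : ∑ i, ζ i ^ 2 = 0) :
    IsPeriodVector (positiveVector ζ) := by
  refine ⟨?_, ?_⟩
  · rw [baseChange_positiveVector_positiveVector]
    simp only [← sq, h, mul_zero]
  · rw [latticeConj_positiveVector, baseChange_positiveVector_positiveVector]
    simp only [Complex.mul_conj, ← Complex.ofReal_sum]
    rw [← Complex.ofReal_ofNat, ← Complex.ofReal_mul, Complex.ofReal_re]
    obtain ⟨i, hi⟩ := Function.ne_iff.mp h0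
    have : 0 < ∑ i, Complex.normSq (ζ i) :=
      Finset.sum_pos' (fun i _ => Complex.normSq_nonneg _)
        ⟨i, Finset.mem_univ _, Complex.normSq_pos.mpr hi⟩
    linarith

/-- An isotropic vector of `ℂ³` orthogonal to a given integral vector. -/
theorem exists_isotropic_orthogonal (c : Fin 3 → ℤ) :
    ∃ ζ : Fin 3 → ℂ, ζ ≠ 0 ∧ ∑ i, ζ i ^ 2 = 0 ∧ ∑ i, ζ i * c i = 0 := by
  by_cases h : c 0 = 0 ∧ c 1 = 0
  · refine ⟨![1, Complex.I, 0], fun h0 => ?_, ?_, ?_⟩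
    · simpa using congrFun h0 0
    · simp [Fin.sum_univ_three]
    · simp [Fin.sum_univ_three, h.1, h.2]
  -- `u + i v` for orthogonal vectors `u`, `v` of equal length in the orthogonal complement of `c`:
  -- `u` is a multiple of `(-c₁, c₀, 0)`, and `v` is the cross product of `c` and `(-c₁, c₀, 0)`.
  · have hpos : 0 < (c 0 : ℝ) ^ 2 + (c 1 : ℝ) ^ 2 := by
      rcases not_and_or.mp h with h | h
      · have : (0 : ℝ) < (c 0 : ℝ) ^ 2 := by positivity
        positivity
      · have : (0 : ℝ) < (c 1 : ℝ) ^ 2 := by positivity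
        positivity
    set n : ℝ := Real.sqrt ((c 0 : ℝ) ^ 2 + (c 1 : ℝ) ^ 2 + (c 2 : ℝ) ^ 2) with hn
    have hn2 : (n : ℂ) ^ 2 = (c 0 : ℂ) ^ 2 + (c 1 : ℂ) ^ 2 + (c 2 : ℂ) ^ 2 := by
      have : n ^ 2 = (c 0 : ℝ) ^ 2 + (c 1 : ℝ) ^ 2 + (c 2 : ℝ) ^ 2 := Real.sq_sqrt (by positivity)
      exact_mod_cast congrArg (Complex.ofReal) this
    have hI : Complex.I ^ 2 = -1 := Complex.I_sq
    refine ⟨![-(n * c 1) - Complex.I * (c 0 * c 2), n * c 0 - Complex.I * (c 1 * c 2),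
      Complex.I * ((c 0) ^ 2 + (c 1) ^ 2)], fun h0 => ?_, ?_, ?_⟩
    · have := congrFun h0 2
      simp only [Matrix.cons_val, Pi.zero_apply, mul_eq_zero, Complex.I_ne_zero, false_or] at this
      exact hpos.ne' (by exact_mod_cast this)
    · simp only [Fin.sum_univ_three, Matrix.cons_val]
      linear_combination ((c 0 : ℂ) ^ 2 + (c 1 : ℂ) ^ 2) * hn2 +
        ((c 0 : ℂ) ^ 2 * (c 2) ^ 2 + (c 1 : ℂ) ^ 2 * (c 2) ^ 2 +
          ((c 0 : ℂ) ^ 2 + (c 1 : ℂ) ^ 2) ^ 2) * hI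
    · simp only [Fin.sum_univ_three, Matrix.cons_val]
      ring

/-- The orthogonal complement of any class `B` contains an algebraic period. -/
theorem exists_isPeriodVector_orthogonal (B : K3Lattice) :
    ∃ x, IsPeriodVector x ∧ k3Form.baseChange ℂ x (1 ⊗ₜ B) = 0 ∧
      ∃ C : K3Lattice, k3Form.baseChange ℂ x (1 ⊗ₜ C) = 0 ∧ 0 < k3Form C C := by
  have p : ∀ i j : Fin 3, k3Form (hypVec i 1 1) (hypVec j 1 1) = if i = j then 2 else 0 :=
    k3Frame.pos_pos
  -- Among the three positive directions take the class proportional to the projection of `B`.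
  have key : ∀ c : Fin 3 → ℤ, c ≠ 0 → ∃ ζ : Fin 3 → ℂ, IsPeriodVector (positiveVector ζ) ∧
      ∑ i, ζ i * c i = 0 ∧
      ∃ C : K3Lattice, k3Form.baseChange ℂ (positiveVector ζ) (1 ⊗ₜ C) = 0 ∧ 0 < k3Form C C := by
    intro c hc
    obtain ⟨ζ, h0, h2, h1⟩ := exists_isotropic_orthogonal c
    have hpair : ∀ j, k3Form (∑ i, c i • hypVec i 1 1) (hypVec j 1 1) = 2 * c j := by
      intro j
      simp only [map_sum, LinearMap.sum_apply, map_smul, LinearMap.smul_apply, p, smul_eq_mul]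
      simp [mul_comm]
    refine ⟨ζ, isPeriodVector_positiveVector h0 h2, h1, ∑ i, c i • hypVec i 1 1, ?_, ?_⟩
    · rw [baseChange_positiveVector]
      simp only [hpair, Int.cast_mul, Int.cast_ofNat, mul_left_comm _ (2 : ℂ), ← Finset.mul_sum, h1,
        mul_zero]
    · have e : k3Form (∑ i, c i • hypVec i 1 1) (∑ i, c i • hypVec i 1 1) = ∑ i, 2 * c i ^ 2 := by
        conv_lhs => rw [map_sum]
        refine Finset.sum_congr rfl fun i _ => ?_
        rw [map_smul, hpair, smul_eq_mul]
        ring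
      rw [e]
      obtain ⟨i, hi⟩ := Function.ne_iff.mp hc
      refine Finset.sum_pos' (fun i _ => by positivity) ⟨i, Finset.mem_univ _, ?_⟩
      have : c i ≠ 0 := hi
      positivity
  by_cases hB : (fun i => k3Form B (hypVec i 1 1)) = 0
  · obtain ⟨ζ, hζ, -, hC⟩ := key (fun _ => 1) (fun h => one_ne_zero (congrFun h 0))
    refine ⟨_, hζ, ?_, hC⟩
    rw [baseChange_positiveVector]
    refine Finset.sum_eq_zero fun i _ => ?_
    rw [show k3Form B (hypVec i 1 1) = 0 from congrFun hB i, Int.cast_zero, mul_zero]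
  · obtain ⟨ζ, hζ, h, hC⟩ := key _ hB
    exact ⟨_, hζ, by rw [baseChange_positiveVector]; exact h, hC⟩

/-- Since `Λ` has only three positive directions, the orthogonal complement of a positive plane
in `Λ` contains no period. -/
theorem not_isPeriodVector_of_orthogonal {x : ℂ ⊗[ℤ] K3Lattice}
    (h0 : k3Form.baseChange ℂ x (1 ⊗ₜ hypVec 0 1 1) = 0)
    (h1 : k3Form.baseChange ℂ x (1 ⊗ₜ hypVec 1 1 1) = 0) : ¬ IsPeriodVector x := by
  rintro ⟨hx, hpos⟩
  have e1 := k3Frame.expansion_baseChange ℂ x x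
  have e2 := k3Frame.expansion_baseChange ℂ x (latticeConj K3Lattice x)
  rw [hx] at e1
  simp only [baseChange_latticeConj, Complex.mul_conj] at e2
  have z0 : k3Form.baseChange ℂ x (1 ⊗ₜ k3Frame.pos 0) = 0 := h0
  have z1 : k3Form.baseChange ℂ x (1 ⊗ₜ k3Frame.pos 1) = 0 := h1
  simp only [Fin.sum_univ_three, z0, z1, map_zero, Complex.ofReal_zero, zero_add,
    mul_zero] at e1 e2
  set z := k3Form.baseChange ℂ x (1 ⊗ₜ k3Frame.pos 2)
  set y : (Fin 2 × Fin 8) ⊕ Fin 3 → ℂ := fun i => k3Form.baseChange ℂ x (1 ⊗ₜ k3Frame.neg i)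
  have n1 : 2 * Complex.normSq z ≤ ∑ i, k3Frame.weight i * Complex.normSq (y i) := by
    have : 2 * (z * z) = ∑ i, (k3Frame.weight i : ℂ) * (y i * y i) := (sub_eq_zero.mp e1.symm)
    have n := congrArg norm this
    rw [norm_mul, norm_mul, ← sq, Complex.sq_norm, Complex.norm_ofNat] at n
    rw [n]
    refine (norm_sum_le _ _).trans_eq (Finset.sum_congr rfl fun i _ => ?_)
    rw [norm_mul, norm_mul, ← sq, Complex.sq_norm, Complex.norm_natCast]
  have n2 : 4 * (k3Form.baseChange ℂ x (latticeConj K3Lattice x)).re =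
      2 * Complex.normSq z - ∑ i, k3Frame.weight i * Complex.normSq (y i) := by
    have := congrArg Complex.re e2
    simpa [y] using this
  linarith

/-! ### Isometries that keep a period a period -/

theorem mem_algPeriodMeetingSet {g : MukaiLattice ≃ₗ[ℤ] MukaiLattice} (hg : g ∈ OplusMukai)
    {x y : ℂ ⊗[ℤ] K3Lattice} (hx : IsPeriodVector x) (hy : IsPeriodVector y)
    (hxB : ∃ B : K3Lattice, k3Form.baseChange ℂ x (1 ⊗ₜ B) = 0 ∧ 0 < k3Form B B)
    (hyB : ∃ B : K3Lattice, k3Form.baseChange ℂ y (1 ⊗ₜ B) = 0 ∧ 0 < k3Form B B)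
    (h : g.baseChange ℤ ℂ MukaiLattice MukaiLattice
      ((LinearMap.inl ℤ K3Lattice HypPlane).baseChange ℂ x) =
        (LinearMap.inl ℤ K3Lattice HypPlane).baseChange ℂ y) :
    g ∈ algPeriodMeetingSet := by
  refine ⟨hg, _, ⟨_, ⟨_, ⟨x, hx.ne_zero, rfl, hx, hxB⟩, rfl⟩, rfl⟩,
    ⟨_, ⟨y, hy.ne_zero, rfl, hy, hyB⟩, ?_⟩⟩
  rw [projAction, projInclusion, Projectivization.map_mk, Projectivization.map_mk,
    Projectivization.map_mk, Projectivization.mk_eq_mk_iff']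
  exact ⟨1, by rw [one_smul]; exact h⟩

theorem algPeriodDomain_subset : algPeriodDomain ⊆ periodDomain :=
  fun _ ⟨x, hx, hp, hper, _⟩ => ⟨x, hx, hp, hper⟩

theorem algPeriodMeetingSet_subset : algPeriodMeetingSet ⊆ periodMeetingSet :=
  fun _ ⟨hg, hne⟩ => ⟨hg, hne.mono (Set.inter_subset_inter
    (Set.image_mono (Set.image_mono algPeriodDomain_subset))
    (Set.image_mono algPeriodDomain_subset))⟩

theorem subOplusK3_subset_algPeriodMeetingSet :
    (subOplusK3 : Set (MukaiLattice ≃ₗ[ℤ] MukaiLattice)) ⊆ algPeriodMeetingSet := by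
  rintro _ ⟨h, hh, rfl⟩
  obtain ⟨x, hx, -, C, hC, hCpos⟩ := exists_isPeriodVector_orthogonal 0
  refine mem_algPeriodMeetingSet (extendK3_mem_OplusMukai_iff.mpr hh) hx (hx.baseChange hh.1)
    ⟨C, hC, hCpos⟩ ⟨h C, ?_, by rwa [hh.1]⟩ ?_
  · have := baseChange_apply_isometry ℂ hh.1 x (1 ⊗ₜ C)
    rwa [LinearEquiv.baseChange_tmul, hC] at this
  · clear hx hC
    induction x with
    | zero => simp
    | add x y hx hy => simp only [map_add, hx, hy]
    | tmul a m => rfl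

theorem subOplusHyp_subset_algPeriodMeetingSet :
    (subOplusHyp : Set (MukaiLattice ≃ₗ[ℤ] MukaiLattice)) ⊆ algPeriodMeetingSet := by
  rintro _ ⟨h, hh, rfl⟩
  obtain ⟨x, hx, -, hC⟩ := exists_isPeriodVector_orthogonal 0
  refine mem_algPeriodMeetingSet (extendHyp_mem_OplusMukai hh) hx hx hC hC ?_
  clear hx hC
  induction x with
  | zero => simp
  | add x y hx hy => simp only [map_add, hx, hy]
  | tmul a m =>
    rw [LinearMap.baseChange_tmul, LinearEquiv.baseChange_tmul, extendHyp_apply]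
    simp

theorem mukaiExp_baseChange_inl (B : Multiplicative K3Lattice) (x : ℂ ⊗[ℤ] K3Lattice) :
    (mukaiExp B).baseChange ℤ ℂ MukaiLattice MukaiLattice
      ((LinearMap.inl ℤ K3Lattice HypPlane).baseChange ℂ x) =
    (LinearMap.inl ℤ K3Lattice HypPlane).baseChange ℂ x +
      k3Form.baseChange ℂ x (1 ⊗ₜ B.toAdd) • (1 ⊗ₜ (0, (0, 1))) := by
  induction x with
  | zero => simp
  | add x y hx hy =>
    simp only [map_add, hx, hy, LinearMap.add_apply, add_smul]
    abel
  | tmul a m =>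
    rw [LinearMap.baseChange_tmul, LinearEquiv.baseChange_tmul, mukaiExp_apply,
      LinearMap.BilinForm.baseChange_tmul, smul_assoc, TensorProduct.smul_tmul',
      ← TensorProduct.tmul_smul, smul_eq_mul, mul_one, mul_one,
      ← TensorProduct.tmul_add, k3Form_comm m]
    simp

theorem subExp_subset_algPeriodMeetingSet :
    (subExp : Set (MukaiLattice ≃ₗ[ℤ] MukaiLattice)) ⊆ algPeriodMeetingSet := by
  rintro _ ⟨B, rfl⟩
  obtain ⟨x, hx, hB, hC⟩ := exists_isPeriodVector_orthogonal B.toAdd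
  refine mem_algPeriodMeetingSet (mukaiExp_mem_OplusMukai B) hx hx hC hC ?_
  rw [mukaiExp_baseChange_inl, hB, zero_smul, add_zero]

theorem mukaiForm_baseChange_inl (x : ℂ ⊗[ℤ] K3Lattice) (m : MukaiLattice) :
    mukaiForm.baseChange ℂ ((LinearMap.inl ℤ K3Lattice HypPlane).baseChange ℂ x) (1 ⊗ₜ m) =
      k3Form.baseChange ℂ x (1 ⊗ₜ m.1) := by
  induction x with
  | zero => simp
  | add x y hx hy => simp only [map_add, hx, hy, LinearMap.add_apply]
  | tmul a n =>
    rw [LinearMap.baseChange_tmul, LinearMap.BilinForm.baseChange_tmul,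
      LinearMap.BilinForm.baseChange_tmul, mukaiForm_apply]
    simp

/-- A period that `g` maps into `Λ_ℂ` is orthogonal to the projection of `g⁻¹(U)` to `Λ`. -/
theorem exists_isPeriodVector_of_mem_periodMeetingSet {g : MukaiLattice ≃ₗ[ℤ] MukaiLattice}
    (hg : g ∈ periodMeetingSet) :
    ∃ x, IsPeriodVector x ∧
      ∀ u : HypPlane, k3Form.baseChange ℂ x (1 ⊗ₜ (g.symm (0, u)).1) = 0 := by
  obtain ⟨hO, _, ⟨_, ⟨_, ⟨x, hx0, rfl, hx⟩, rfl⟩, rfl⟩, ⟨_, ⟨y, hy0, rfl, hy⟩, h⟩⟩ := hg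
  rw [projAction, projInclusion, Projectivization.map_mk, Projectivization.map_mk,
    Projectivization.map_mk, Projectivization.mk_eq_mk_iff'] at h
  obtain ⟨a, ha⟩ := h
  have ha0 : a ≠ 0 := by
    rintro rfl
    rw [zero_smul] at ha
    exact hy0 (inl_baseChange_injective (by rw [← ha, map_zero]))
  refine ⟨x, hx, fun u => ?_⟩
  have h1 := baseChange_apply_isometry ℂ hO.1
    ((LinearMap.inl ℤ K3Lattice HypPlane).baseChange ℂ x) (1 ⊗ₜ g.symm (0, u))
  rw [mukaiForm_baseChange_inl, LinearEquiv.baseChange_tmul, LinearEquiv.apply_symm_apply] at h1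
  have h2 := congrArg (fun w => mukaiForm.baseChange ℂ w (1 ⊗ₜ (0, u))) ha
  simp only [map_smul, LinearMap.smul_apply, LinearEquiv.coe_coe] at h2
  rw [h1, mukaiForm_baseChange_inl] at h2
  have h3 : a * k3Form.baseChange ℂ x (1 ⊗ₜ (g.symm (0, u)).1) = 0 := by
    simpa using h2
  exact (mul_eq_zero.mp h3).resolve_left ha0

/-- An isometry for which the projection of `g⁻¹(U)` to `Λ` is a positive plane moves all
periods away from the periods. -/
theorem exists_mem_OplusMukai_notMem_periodMeetingSet :
    ∃ g ∈ OplusMukai, g ∉ periodMeetingSet := by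
  set γ := mukaiCoexp (hypVec 1 1 1) * mukaiExp (.ofAdd (hypVec 0 1 1)) with hγ
  have hmem : γ ∈ OplusMukai := mukaiGenerated_le (mul_mem (mukaiCoexp_mem _) (mukaiExp_mem _))
  refine ⟨γ⁻¹, inv_mem hmem, fun hcon => ?_⟩
  obtain ⟨x, hx, h⟩ := exists_isPeriodVector_of_mem_periodMeetingSet hcon
  have h1 : k3Form.baseChange ℂ x (1 ⊗ₜ hypVec 1 1 1) = 0 := by
    have := h (0, 1)
    change k3Form.baseChange ℂ x (1 ⊗ₜ (γ (0, (0, 1))).1) = 0 at this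
    have e : (γ (0, (0, 1))).1 = -hypVec 1 1 1 := by
      simp [hγ, LinearEquiv.mul_apply, mukaiExp_apply, mukaiCoexp_apply]
    rwa [e, TensorProduct.tmul_neg, map_neg, neg_eq_zero] at this
  have h0 : k3Form.baseChange ℂ x (1 ⊗ₜ hypVec 0 1 1) = 0 := by
    have := h (1, 0)
    change k3Form.baseChange ℂ x (1 ⊗ₜ (γ (0, (1, 0))).1) = 0 at this
    have e : (γ (0, (1, 0))).1 = hypVec 0 1 1 - hypVec 1 1 1 := by
      have q : k3Form (hypVec 0 1 1) (hypVec 0 1 1) / 2 = 1 := by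
        simp [k3Form_hypVec, hypVec_inr]
      simp [hγ, LinearEquiv.mul_apply, mukaiExp_apply, mukaiCoexp_apply, q]
    rwa [e, TensorProduct.tmul_sub, map_sub, h1, sub_zero] at this
  exact not_isPeriodVector_of_orthogonal h0 h1 hx

theorem proposition6p1 :
    algPeriodMeetingSet ⊆ periodMeetingSet ∧
    periodMeetingSet ⊆ (OplusMukai : Set (MukaiLattice ≃ₗ[ℤ] MukaiLattice)) ∧
    -- both sets contain the three subgroups
    ((subOplusK3 : Set (MukaiLattice ≃ₗ[ℤ] MukaiLattice)) ⊆ algPeriodMeetingSet ∧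
      (subOplusHyp : Set (MukaiLattice ≃ₗ[ℤ] MukaiLattice)) ⊆ algPeriodMeetingSet ∧
      (subExp : Set (MukaiLattice ≃ₗ[ℤ] MukaiLattice)) ⊆ algPeriodMeetingSet) ∧
    ((subOplusK3 : Set (MukaiLattice ≃ₗ[ℤ] MukaiLattice)) ⊆ periodMeetingSet ∧
      (subOplusHyp : Set (MukaiLattice ≃ₗ[ℤ] MukaiLattice)) ⊆ periodMeetingSet ∧
      (subExp : Set (MukaiLattice ≃ₗ[ℤ] MukaiLattice)) ⊆ periodMeetingSet) ∧
    -- these subgroups, and thus both sets, generate the whole group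
    subOplusK3 ⊔ subOplusHyp ⊔ subExp = OplusMukai ∧
    Subgroup.closure algPeriodMeetingSet = OplusMukai ∧
    Subgroup.closure periodMeetingSet = OplusMukai ∧
    -- neither set is the whole group, and neither set is a subgroup
    periodMeetingSet ≠ (OplusMukai : Set (MukaiLattice ≃ₗ[ℤ] MukaiLattice)) ∧
    algPeriodMeetingSet ≠ (OplusMukai : Set (MukaiLattice ≃ₗ[ℤ] MukaiLattice)) ∧
    (¬ ∃ K : Subgroup (MukaiLattice ≃ₗ[ℤ] MukaiLattice),
      (K : Set (MukaiLattice ≃ₗ[ℤ] MukaiLattice)) = periodMeetingSet) ∧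
    (¬ ∃ K : Subgroup (MukaiLattice ≃ₗ[ℤ] MukaiLattice),
      (K : Set (MukaiLattice ≃ₗ[ℤ] MukaiLattice)) = algPeriodMeetingSet) := by
  have hHalg : (OplusMukai : Set (MukaiLattice ≃ₗ[ℤ] MukaiLattice)) ⊇ algPeriodMeetingSet :=
    fun _ hg => hg.1
  have hH : (OplusMukai : Set (MukaiLattice ≃ₗ[ℤ] MukaiLattice)) ⊇ periodMeetingSet :=
    fun _ hg => hg.1
  have hcl : Subgroup.closure algPeriodMeetingSet = OplusMukai := by
    refine le_antisymm ((Subgroup.closure_le _).mpr hHalg) ?_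
    rw [← mukaiGenerated_eq]
    exact sup_le (sup_le
      (fun _ h => Subgroup.subset_closure (subOplusK3_subset_algPeriodMeetingSet h))
      (fun _ h => Subgroup.subset_closure (subOplusHyp_subset_algPeriodMeetingSet h)))
      (fun _ h => Subgroup.subset_closure (subExp_subset_algPeriodMeetingSet h))
  have hcl' : Subgroup.closure periodMeetingSet = OplusMukai :=
    le_antisymm ((Subgroup.closure_le _).mpr hH)
      (hcl.ge.trans (Subgroup.closure_mono algPeriodMeetingSet_subset))
  obtain ⟨g, hg, hgH⟩ := exists_mem_OplusMukai_notMem_periodMeetingSet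
  have hne : periodMeetingSet ≠ (OplusMukai : Set (MukaiLattice ≃ₗ[ℤ] MukaiLattice)) :=
    fun h => hgH (h.symm ▸ hg)
  have hne' : algPeriodMeetingSet ≠ (OplusMukai : Set (MukaiLattice ≃ₗ[ℤ] MukaiLattice)) :=
    fun h => hgH (algPeriodMeetingSet_subset (h.symm ▸ hg))
  refine ⟨algPeriodMeetingSet_subset, hH,
    ⟨subOplusK3_subset_algPeriodMeetingSet, subOplusHyp_subset_algPeriodMeetingSet,
      subExp_subset_algPeriodMeetingSet⟩,
    ⟨subOplusK3_subset_algPeriodMeetingSet.trans algPeriodMeetingSet_subset,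
      subOplusHyp_subset_algPeriodMeetingSet.trans algPeriodMeetingSet_subset,
      subExp_subset_algPeriodMeetingSet.trans algPeriodMeetingSet_subset⟩,
    mukaiGenerated_eq, hcl, hcl', hne, hne', ?_, ?_⟩
  -- A subgroup equals the subgroup it generates, which here is everything.
  · rintro ⟨K, hK⟩
    rw [← hK, Subgroup.closure_eq] at hcl'
    exact hne (by rw [← hK, hcl'])
  · rintro ⟨K, hK⟩
    rw [← hK, Subgroup.closure_eq] at hcl
    exact hne' (by rw [← hK, hcl])
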